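/- **Conventions.** A *CAT(0) cube complex* is a cube complex (a non-empty complex of finite-dimensional Euclidean unit cubes, glued by isometries of faces so that cubes are embedded and two cubes that meet do so in a common face; neither finite-dimensionality nor local finiteness is assumed) that is connected and simply connected and in which the link of every vertex is a flag simplicial complex; equivalently, by Gromov's criterion, its length metric is a CAT(0) geodesic metric. Groups act on it by cellular automorphisms mapping cubes isometrically to cubes. Call two edges parallel if they are related by the equivalence relation generated by being opposite sides of a square; a *hyperplane* is the union of the midcubes dual to the edges of one parallelism class. The group $G$ acts *without inversions* if every element of $G$ that stabilizes a hyperplane $\Lambda$ also stabilizes each component of the complement of $\Lambda$. A subgroup $H$ of a finitely generated group $G$ is *codimension-1* if the quotient $H\backslash\Upsilon$ of the Cayley graph $\Upsilon$ of $G$ with respect to a finite generating set has more than one end (this does not depend on the generating set). **Theorem (Gerasimov).** Let $G$ be a finitely generated group acting without inversions on a CAT(0) cube complex $X$, and suppose that no $0$-cube of $X$ is fixed by $G$. Then there is a hyperplane $\Lambda$ of $X$ whose stabilizer $\mathrm{Stab}_G(\Lambda)$ is a codimension-1 subgroup of $G$. -/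

import Mathlib

/-- A face of the combinatorial cube `{0,1}ⁿ`: the set of vertices obtained by prescribing
some of the coordinates. -/
def IsCubeFace {n : ℕ} (F : Set (Fin n → Bool)) : Prop :=
  ∃ (J : Set (Fin n)) (a : Fin n → Bool), F = {x | ∀ i ∈ J, x i = a i}

/-- A cube complex with set of `0`-cubes `V`. Every (closed) cube is recorded by its set of
vertices: it is a copy of `{0,1}ⁿ` for some finite `n`, the cubes contained in it are exactly
its faces, and two cubes that meet do so in a common face. The dimension need not be bounded,
and the complex need not be locally finite. -/
structure CubeComplex (V : Type*) where
  /-- the vertex sets of the cubes -/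
  cubes : Set (Set V)
  /-- every element of `V` is a `0`-cube -/
  singleton_mem : ∀ v : V, {v} ∈ cubes
  /-- every cube is a combinatorial `n`-cube, whose subcubes are its faces -/
  exists_chart : ∀ c ∈ cubes, ∃ (n : ℕ) (f : (Fin n → Bool) → V),
    Function.Injective f ∧ Set.range f = c ∧
      ∀ s : Set V, s ⊆ c → (s ∈ cubes ↔ IsCubeFace (f ⁻¹' s))
  /-- two cubes that meet intersect in a cube, which is a face of both -/
  inter_mem : ∀ c ∈ cubes, ∀ d ∈ cubes, (c ∩ d).Nonempty → c ∩ d ∈ cubes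

namespace CubeComplex

variable {V : Type*} (X : CubeComplex V)

/-- The `1`-skeleton. -/
def graph : SimpleGraph V where
  Adj u v := u ≠ v ∧ ({u, v} : Set V) ∈ X.cubes
  symm := ⟨fun u v h => ⟨h.1.symm, by rw [Set.pair_comm]; exact h.2⟩⟩
  loopless := ⟨fun _ h => h.1 rfl⟩

/-- `a, b, c, d` are, in cyclic order, the vertices of a `2`-cube. -/
def Square (a b c d : V) : Prop :=
  a ≠ c ∧ b ≠ d ∧ X.graph.Adj a b ∧ X.graph.Adj b c ∧ X.graph.Adj c d ∧ X.graph.Adj d a ∧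
    ({a, b, c, d} : Set V) ∈ X.cubes

/-- Homotopy, relative to the endpoints, of paths in the `1`-skeleton: the equivalence relation
generated by removing a backtrack and by replacing two consecutive sides of a `2`-cube by the
two other sides. -/
inductive Homotopic : {u v : V} → X.graph.Walk u v → X.graph.Walk u v → Prop
  | refl {u v : V} (p : X.graph.Walk u v) : Homotopic p p
  | symm {u v : V} {p q : X.graph.Walk u v} : Homotopic p q → Homotopic q p
  | trans {u v : V} {p q r : X.graph.Walk u v} :
      Homotopic p q → Homotopic q r → Homotopic p r
  | backtrack {u a b v : V} (p : X.graph.Walk u a) (h : X.graph.Adj a b)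
      (q : X.graph.Walk a v) :
      Homotopic (p.append (.cons h (.cons h.symm q))) (p.append q)
  | square {u a b c d v : V} (p : X.graph.Walk u a) (q : X.graph.Walk c v)
      (hab : X.graph.Adj a b) (hbc : X.graph.Adj b c)
      (had : X.graph.Adj a d) (hdc : X.graph.Adj d c) (hsq : X.Square a b c d) :
      Homotopic (p.append (.cons hab (.cons hbc q))) (p.append (.cons had (.cons hdc q)))

/-- The complex is (nonempty and) connected, with trivial edge-path group at every vertex. -/
def IsSimplyConnected : Prop :=
  X.graph.Connected ∧ ∀ (v : V) (p : X.graph.Walk v v), X.Homotopic p .nil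

/-- The link of the vertex `v` is the simplicial complex whose vertices are the neighbours of
`v` (that is, the edges at `v`) and whose simplices are the sets of all neighbours of `v` in
a cube containing `v`. -/
def IsLinkSimplex (v : V) (T : Set V) : Prop :=
  ∃ c ∈ X.cubes, v ∈ c ∧ c ∩ X.graph.neighborSet v = T

/-- All vertex links are flag: finitely many pairwise adjacent vertices of a link span a
simplex of that link. -/
def HasFlagLinks : Prop :=
  ∀ (v : V) (T : Finset V), (∀ w ∈ T, X.graph.Adj v w) →
    (∀ w ∈ T, ∀ w' ∈ T, w ≠ w' → X.IsLinkSimplex v {w, w'}) → X.IsLinkSimplex v T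

/-- A CAT(0) cube complex: a simply connected cube complex with flag links. -/
def IsCAT0 : Prop := X.IsSimplyConnected ∧ X.HasFlagLinks

/-- Two edges (unordered pairs of vertices) are opposite sides of a `2`-cube. -/
def Opposite (e f : Sym2 V) : Prop :=
  ∃ a b c d : V, X.Square a b c d ∧ e = s(a, b) ∧ f = s(d, c)

/-- The hyperplanes. A hyperplane is represented by the set of edges dual to it (those that it
crosses), a class of the equivalence relation on edges generated by being opposite in a
`2`-cube. -/
def hyperplanes : Set (Set (Sym2 V)) :=
  {Λ | ∃ e ∈ X.graph.edgeSet, Λ = {f | Relation.EqvGen X.Opposite e f}}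

variable (G : Type*) [Group G] [MulAction G V]

/-- The action of `G` on the vertices is an action on the cube complex: it maps cubes to cubes
(hence faces to faces). -/
def IsCubicalAction : Prop :=
  ∀ (g : G), ∀ c ∈ X.cubes, (fun v => g • v) '' c ∈ X.cubes

/-- The stabilizer in `G` of a hyperplane (given as a set of edges). -/
def hyperplaneStabilizer (Λ : Set (Sym2 V)) : Subgroup G where
  carrier := {g | Sym2.map (fun v => g • v) '' Λ = Λ}
  one_mem' := by simp
  mul_mem' := by
    intro a b ha hb
    have ha' : Sym2.map (fun v => a • v) '' Λ = Λ := ha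
    have hb' : Sym2.map (fun v => b • v) '' Λ = Λ := hb
    have h : Sym2.map (fun v : V => (a * b) • v) =
        Sym2.map (fun v : V => a • v) ∘ Sym2.map (fun v : V => b • v) := by
      rw [← Sym2.map_comp]
      congr 1
      funext v
      exact mul_smul a b v
    change Sym2.map (fun v : V => (a * b) • v) '' Λ = Λ
    rw [h, Set.image_comp, hb', ha']
  inv_mem' := by
    intro a ha
    have ha' : Sym2.map (fun v => a • v) '' Λ = Λ := ha
    have h : Sym2.map (fun v : V => a⁻¹ • v) ∘ Sym2.map (fun v : V => a • v) = id := by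
      rw [← Sym2.map_comp]
      have : ((fun v : V => a⁻¹ • v) ∘ fun v : V => a • v) = id := by
        funext v
        exact inv_smul_smul a v
      rw [this, Sym2.map_id]
    change Sym2.map (fun v : V => a⁻¹ • v) '' Λ = Λ
    conv_lhs => rw [← ha']
    rw [← Set.image_comp, h, Set.image_id]

/-- `G` acts without inversions: the stabilizer of a hyperplane also stabilizes each component
of its complement. Such a component is given by its vertices, and two vertices lie in the same
component when a path in the `1`-skeleton joins them that does not cross the hyperplane. -/
def ActsWithoutInversions : Prop :=
  ∀ Λ ∈ X.hyperplanes, ∀ g ∈ hyperplaneStabilizer G Λ,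
    ∀ C : (X.graph.deleteEdges Λ).ConnectedComponent, (fun v => g • v) '' C.supp = C.supp

end CubeComplex

/-- The quotient `H \ Υ` of the Cayley graph `Υ` of `G` with respect to `S` (with edges joining
`g` and `g * s`) by the left action of `H`. Its vertices are the cosets `H g`; loops and
repeated edges are dropped, which does not affect the ends. -/
def cayleyQuotient {G : Type*} [Group G] (H : Subgroup G) (S : Set G) :
    SimpleGraph (Quotient (QuotientGroup.rightRel H)) :=
  SimpleGraph.fromRel fun a b =>
    ∃ g : G, ∃ s ∈ S, a = Quotient.mk _ g ∧ b = Quotient.mk _ (g * s)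

/-- `H` is a codimension-1 subgroup of the finitely generated group `G`: the quotient by `H` of
the Cayley graph with respect to a finite generating set (and then to any of them) has more than
one end. -/
def IsCodimensionOne {G : Type*} [Group G] (H : Subgroup G) : Prop :=
  Group.FG G ∧ ∀ S : Set G, S.Finite → Subgroup.closure S = ⊤ →
    (cayleyQuotient H S).end.Nontrivial

/-! Suppose that no hyperplane stabilizer is codimension-1; a fixed vertex is then constructed.

Combinatorial geometry of `X`. Edge paths are rewritten by pushing across squares and deleting
backtracks. Flag links complete three squares at a corner to a 3-cube, which makes this rewriting
confluent (`Steps.confluent`). With simple connectivity it follows that a path which cannot be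
shortened crosses every hyperplane at most once (`Reduced.cross_le_one`), and that the parity of
crossings defines two sides of each hyperplane (`sep_iff`).

Choosing sides. For a hyperplane `Λ` with stabilizer `H`, the set of `g` with `g • y` on a given
side of `Λ` is `H`-invariant, since there are no inversions, and has `H`-finite coboundary, since
finitely many hyperplanes separate two vertices. As `H` is not codimension-1, one side is small:
only finitely many cosets `H g` put `g • y` there (`finite_sameSide_or`). If `Λ` has infinitely many
translates, exactly one side is small. A vertex has only finitely many such hyperplanes on whose
small side it lies (`finite_bad`), and they can be crossed one at a time; B. H. Neumann's lemma on
coset coverings shows that no other hyperplane is in the way (`exists_bad_eq_empty`).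

Fixed vertex. At a vertex `y` on no small side, only finitely many hyperplanes separate points of
the orbit of `y` (`finite_essential`). Take a minimal halfspace bounded by one of them. Those of its
translates that contain `y` are bounded by pairwise crossing hyperplanes adjacent to `y`, so all of
these can be crossed at once. The new vertex has strictly fewer hyperplanes separating its orbit
(`exists_essential_ssubset`). When none is left, the orbit is a single vertex. -/

namespace CubeComplex

/-! ### Squares and 3-cubes in coordinates -/

/-- Change the `i`-th coordinate of a vertex of the combinatorial cube. -/
def toggle {n : ℕ} (u : Fin n → Bool) (i : Fin n) : Fin n → Bool := Function.update u i (!u i)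

theorem toggle_same {n : ℕ} (u : Fin n → Bool) (i : Fin n) : toggle u i i = !u i := by
  simp [toggle]

theorem toggle_of_ne {n : ℕ} (u : Fin n → Bool) {i j : Fin n} (h : j ≠ i) :
    toggle u i j = u j := by
  simp [toggle, h]

theorem toggle_ne {n : ℕ} (u : Fin n → Bool) (i : Fin n) : toggle u i ≠ u := fun h => by
  have := congrFun h i
  simp [toggle_same] at this

theorem toggle_injective {n : ℕ} (u : Fin n → Bool) {i j : Fin n} (h : toggle u i = toggle u j) :
    i = j := by
  by_contra hij
  have := congrFun h i
  rw [toggle_same, toggle_of_ne u hij] at this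
  simp at this

theorem toggle_comm {n : ℕ} (u : Fin n → Bool) (i j : Fin n) :
    toggle (toggle u i) j = toggle (toggle u j) i := by
  by_cases hij : i = j
  · rw [hij]
  funext k
  by_cases hi : k = i
  · subst hi; simp [toggle_same, toggle_of_ne _ hij]
  · by_cases hj : k = j
    · subst hj; simp [toggle_same, toggle_of_ne _ hi]
    · simp [toggle_of_ne _ hi, toggle_of_ne _ hj]

theorem eq_toggle_of_isCubeFace_pair {n : ℕ} {u v : Fin n → Bool} (huv : u ≠ v)
    (h : IsCubeFace ({u, v} : Set (Fin n → Bool))) : ∃ i, v = toggle u i := by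
  obtain ⟨J, a, hF⟩ := h
  obtain ⟨i, hi⟩ := Function.ne_iff.1 huv
  have hu : u ∈ {x : Fin n → Bool | ∀ i ∈ J, x i = a i} := hF ▸ Or.inl rfl
  have hv : v ∈ {x : Fin n → Bool | ∀ i ∈ J, x i = a i} := hF ▸ Or.inr rfl
  have hiJ : i ∉ J := fun hJ => hi ((hu i hJ).trans (hv i hJ).symm)
  have hw : toggle u i ∈ ({u, v} : Set (Fin n → Bool)) := by
    rw [hF]
    intro j hj
    rw [toggle_of_ne u (fun e => hiJ (by rwa [← e]))]
    exact hu j hj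
  rcases hw with h | h
  · exact absurd h (toggle_ne u i)
  · exact ⟨i, (Set.mem_singleton_iff.1 h).symm⟩

theorem isCubeFace_pair {n : ℕ} (u : Fin n → Bool) (i : Fin n) :
    IsCubeFace ({u, toggle u i} : Set (Fin n → Bool)) := by
  refine ⟨{i}ᶜ, u, ?_⟩
  ext x
  simp only [Set.mem_insert_iff, Set.mem_singleton_iff, Set.mem_compl_iff, Set.mem_ofPred_eq]
  constructor
  · rintro (rfl | rfl) j hj
    · rfl
    · exact toggle_of_ne u hj
  · intro h
    by_cases hx : x i = u i
    · left
      funext j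
      by_cases hj : j = i
      · rw [hj, hx]
      · exact h j hj
    · right
      funext j
      by_cases hj : j = i
      · subst hj
        rw [toggle_same]
        exact (Bool.eq_not).2 hx
      · rw [toggle_of_ne u hj, h j hj]

theorem isCubeFace_square {n : ℕ} (u : Fin n → Bool) {i j : Fin n} (hij : i ≠ j) :
    IsCubeFace ({u, toggle u i, toggle (toggle u i) j, toggle u j} : Set (Fin n → Bool)) := by
  refine ⟨{i, j}ᶜ, u, ?_⟩
  ext x
  simp only [Set.mem_insert_iff, Set.mem_singleton_iff, Set.mem_compl_iff, Set.mem_ofPred_eq,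
    not_or]
  constructor
  · rintro (rfl | rfl | rfl | rfl) k ⟨hki, hkj⟩ <;> simp [toggle_of_ne, hki, hkj]
  · intro h
    have key : ∀ y : Fin n → Bool, (∀ k, k ≠ i ∧ k ≠ j → y k = u k) → x i = y i → x j = y j →
        x = y := by
      intro y hy h1 h2
      funext k
      by_cases hki : k = i
      · rw [hki, h1]
      · by_cases hkj : k = j
        · rw [hkj, h2]
        · rw [h k ⟨hki, hkj⟩, hy k ⟨hki, hkj⟩]
    by_cases h1 : x i = u i <;> by_cases h2 : x j = u j
    · exact Or.inl (key u (fun _ _ => rfl) h1 h2)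
    · refine Or.inr (Or.inr (Or.inr (key _ ?_ ?_ ?_)))
      · intro k hk; simp [toggle_of_ne _ hk.2]
      · rw [toggle_of_ne _ hij, h1]
      · rw [toggle_same]; exact (Bool.eq_not).2 h2
    · refine Or.inr (Or.inl (key _ ?_ ?_ ?_))
      · intro k hk; simp [toggle_of_ne _ hk.1]
      · rw [toggle_same]; exact (Bool.eq_not).2 h1
      · rw [toggle_of_ne _ (Ne.symm hij), h2]
    · refine Or.inr (Or.inr (Or.inl (key _ ?_ ?_ ?_)))
      · intro k hk; simp [toggle_of_ne _ hk.1, toggle_of_ne _ hk.2]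
      · rw [toggle_of_ne _ hij, toggle_same]; exact (Bool.eq_not).2 h1
      · rw [toggle_same, toggle_of_ne _ (Ne.symm hij)]; exact (Bool.eq_not).2 h2

/-- Neither `i` nor `j` can be a coordinate prescribed by the face, so changing both stays inside
it. -/
theorem toggle_toggle_mem_of_isCubeFace {n : ℕ} {F : Set (Fin n → Bool)} (hF : IsCubeFace F)
    {u : Fin n → Bool} {i j : Fin n} (hu : u ∈ F) (hi : toggle u i ∈ F) (hj : toggle u j ∈ F) :
    toggle (toggle u i) j ∈ F := by
  obtain ⟨J, a, rfl⟩ := hF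
  have aux : ∀ k, toggle u k ∈ {x : Fin n → Bool | ∀ i ∈ J, x i = a i} → k ∉ J := by
    intro k hk hkJ
    have h1 := hk k hkJ
    rw [toggle_same, ← hu k hkJ] at h1
    simp at h1
  intro k hk
  have hki : k ≠ i := fun h => aux i hi (h ▸ hk)
  have hkj : k ≠ j := fun h => aux j hj (h ▸ hk)
  rw [toggle_of_ne _ hkj, toggle_of_ne _ hki]
  exact hu k hk

variable {V : Type*} {X : CubeComplex V}

theorem exists_toggle_of_adj {c : Set V} {n : ℕ} {f : (Fin n → Bool) → V}
    (hf : Function.Injective f) (hr : Set.range f = c)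
    (hs : ∀ s : Set V, s ⊆ c → (s ∈ X.cubes ↔ IsCubeFace (f ⁻¹' s)))
    {u : Fin n → Bool} {y : V} (hy : y ∈ c) (h : X.graph.Adj (f u) y) :
    ∃ i, y = f (toggle u i) := by
  rw [← hr] at hy
  obtain ⟨v, rfl⟩ := hy
  have hsub : ({f u, f v} : Set V) ⊆ c := by
    rw [← hr]; rintro _ (rfl | rfl)
    · exact ⟨u, rfl⟩
    · exact ⟨v, rfl⟩
  have hface := (hs _ hsub).1 h.2
  rw [← Set.image_pair, hf.preimage_image] at hface
  obtain ⟨i, rfl⟩ := eq_toggle_of_isCubeFace_pair (fun e => h.1 (congrArg f e)) hface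
  exact ⟨i, rfl⟩

theorem adj_toggle {c : Set V} {n : ℕ} {f : (Fin n → Bool) → V}
    (hf : Function.Injective f) (hr : Set.range f = c)
    (hs : ∀ s : Set V, s ⊆ c → (s ∈ X.cubes ↔ IsCubeFace (f ⁻¹' s)))
    (u : Fin n → Bool) (i : Fin n) : X.graph.Adj (f u) (f (toggle u i)) := by
  refine ⟨fun h => toggle_ne u i (hf h).symm, ?_⟩
  rw [hs]
  · rw [← Set.image_pair, hf.preimage_image]
    exact isCubeFace_pair u i
  · rw [← hr]; rintro _ (rfl | rfl) <;> exact ⟨_, rfl⟩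

theorem square_toggle {c : Set V} {n : ℕ} {f : (Fin n → Bool) → V}
    (hf : Function.Injective f) (hr : Set.range f = c)
    (hs : ∀ s : Set V, s ⊆ c → (s ∈ X.cubes ↔ IsCubeFace (f ⁻¹' s)))
    (u : Fin n → Bool) {i j : Fin n} (hij : i ≠ j) :
    X.Square (f u) (f (toggle u i)) (f (toggle (toggle u i) j)) (f (toggle u j)) := by
  have hadj := adj_toggle hf hr hs
  refine ⟨fun h => ?_, fun h => hij (toggle_injective u (hf h)), hadj u i, hadj _ j, ?_,
    (hadj u j).symm, ?_⟩
  · have := congrFun (hf h) i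
    rw [toggle_of_ne _ hij, toggle_same] at this
    simp at this
  · rw [toggle_comm]; exact (hadj _ i).symm
  · rw [hs]
    · have : ({f u, f (toggle u i), f (toggle (toggle u i) j), f (toggle u j)} : Set V) =
          f '' {u, toggle u i, toggle (toggle u i) j, toggle u j} := by
        simp [Set.image_insert_eq]
      rw [this, hf.preimage_image]
      exact isCubeFace_square u hij
    · rw [← hr]; rintro _ (rfl | rfl | rfl | rfl) <;> exact ⟨_, rfl⟩

theorem Square.rotate {a b c d : V} (h : X.Square a b c d) : X.Square b c d a := by
  obtain ⟨h1, h2, h3, h4, h5, h6, h7⟩ := h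
  refine ⟨h2, h1.symm, h4, h5, h6, h3, ?_⟩
  convert h7 using 1
  ext x; simp only [Set.mem_insert_iff, Set.mem_singleton_iff]; tauto

theorem Square.reflect {a b c d : V} (h : X.Square a b c d) : X.Square a d c b := by
  obtain ⟨h1, h2, h3, h4, h5, h6, h7⟩ := h
  refine ⟨h1, h2.symm, h6.symm, h5.symm, h4.symm, h3.symm, ?_⟩
  convert h7 using 1
  ext x; simp only [Set.mem_insert_iff, Set.mem_singleton_iff]; tauto

theorem Square.bcda {a b c d : V} (h : X.Square a b c d) : X.Square b c d a := h.rotate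

theorem Square.cdab {a b c d : V} (h : X.Square a b c d) : X.Square c d a b := h.rotate.rotate

theorem Square.dabc {a b c d : V} (h : X.Square a b c d) : X.Square d a b c := h.cdab.rotate

theorem Square.adcb {a b c d : V} (h : X.Square a b c d) : X.Square a d c b := h.reflect

theorem Square.badc {a b c d : V} (h : X.Square a b c d) : X.Square b a d c := h.rotate.reflect

theorem Square.cbad {a b c d : V} (h : X.Square a b c d) : X.Square c b a d := h.cdab.reflect

theorem Square.dcba {a b c d : V} (h : X.Square a b c d) : X.Square d c b a := h.dabc.reflect

/-- A square in a chart. -/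
theorem Square.exists_chart {a b c d : V} (h : X.Square a b c d) :
    ∃ (n : ℕ) (f : (Fin n → Bool) → V) (u : Fin n → Bool) (i j : Fin n),
      Function.Injective f ∧ Set.range f = {a, b, c, d} ∧
      (∀ s : Set V, s ⊆ {a, b, c, d} → (s ∈ X.cubes ↔ IsCubeFace (f ⁻¹' s))) ∧
      i ≠ j ∧ a = f u ∧ b = f (toggle u i) ∧ d = f (toggle u j) ∧
      c = f (toggle (toggle u i) j) := by
  obtain ⟨hac, hbd, hab, hbc, hcd, hda, hmem⟩ := h
  obtain ⟨n, f, hf, hr, hs⟩ := X.exists_chart _ hmem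
  obtain ⟨u, rfl⟩ : a ∈ Set.range f := by rw [hr]; simp
  obtain ⟨i, rfl⟩ := exists_toggle_of_adj hf hr hs (by simp) hab
  obtain ⟨j, rfl⟩ := exists_toggle_of_adj hf hr hs (by simp) hda.symm
  have hij : i ≠ j := fun e => hbd (by rw [e])
  have hsq := square_toggle hf hr hs u hij
  have hm : f (toggle (toggle u i) j) ∈ ({f u, f (toggle u i), c, f (toggle u j)} : Set V) := by
    rw [← hr]; exact ⟨_, rfl⟩
  refine ⟨n, f, u, i, j, hf, hr, hs, hij, rfl, rfl, rfl, ?_⟩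
  rcases hm with h | h | h | h
  · exact absurd h.symm hsq.1
  · exact absurd h.symm hsq.2.2.2.1.ne
  · exact h.symm
  · exact absurd h hsq.2.2.2.2.1.ne

/-- The two squares meet in a common face; a face containing a corner and both its neighbours
contains the fourth corner too. -/
theorem Square.unique {a b c d c' : V} (h : X.Square a b c d) (h' : X.Square a b c' d) :
    c = c' := by
  have hint := X.inter_mem _ h.2.2.2.2.2.2 _ h'.2.2.2.2.2.2 ⟨a, by simp, by simp⟩
  have hca := h.1
  have hbc := h.2.2.2.1.ne
  have hcd := h.2.2.2.2.1.ne
  obtain ⟨n, f, u, i, j, hf, hr, hs, hij, ha, hb, hd, hc⟩ := h.exists_chart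
  have hface := (hs _ Set.inter_subset_left).1 hint
  have hm := toggle_toggle_mem_of_isCubeFace hface (u := u) (i := i) (j := j)
    (by simp [← ha]) (by simp [← hb]) (by simp [← hd])
  have : c ∈ ({a, b, c', d} : Set V) := by
    have h2 := hm.2
    rwa [← hc] at h2
  rcases this with h | h | h | h
  · exact absurd h.symm hca
  · exact absurd h.symm hbc
  · exact h
  · exact absurd h hcd

theorem Square.not_adj_diagonal {a b c d : V} (h : X.Square a b c d) : ¬ X.graph.Adj a c := by
  intro hac
  obtain ⟨n, f, u, i, j, hf, hr, hs, hij, rfl, rfl, rfl, rfl⟩ := h.exists_chart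
  obtain ⟨k, hk⟩ := exists_toggle_of_adj hf hr hs (by simp) hac
  have hk := hf hk
  have hi : k = i := by
    by_contra hne
    have := congrFun hk i
    rw [toggle_of_ne _ hij, toggle_same, toggle_of_ne _ (Ne.symm hne)] at this
    simp at this
  have hj : k = j := by
    by_contra hne
    have := congrFun hk j
    rw [toggle_same, toggle_of_ne _ (Ne.symm hij), toggle_of_ne _ (Ne.symm hne)] at this
    simp at this
  exact hij (hi.symm.trans hj)

theorem Square.isLinkSimplex {v x p y : V} (h : X.Square v x p y) : X.IsLinkSimplex v {x, y} := by
  refine ⟨_, h.2.2.2.2.2.2, by simp, ?_⟩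
  ext z
  simp only [Set.mem_inter_iff, Set.mem_insert_iff, Set.mem_singleton_iff,
    SimpleGraph.mem_neighborSet]
  constructor
  · rintro ⟨rfl | rfl | rfl | rfl, hz⟩
    · exact absurd rfl hz.ne
    · exact Or.inl rfl
    · exact absurd hz h.not_adj_diagonal
    · exact Or.inr rfl
  · rintro (rfl | rfl)
    · exact ⟨by simp, h.2.2.1⟩
    · exact ⟨by simp, h.2.2.2.2.2.1.symm⟩

/-- In a complex with flag links, three squares that share a vertex, and pairwise an edge, are
completed to a `3`-cube. -/
theorem HasFlagLinks.exists_cube (hX : X.HasFlagLinks) {v x y z p q r : V}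
    (hxy : X.Square v x p y) (hxz : X.Square v x q z) (hyz : X.Square v y r z) :
    ∃ t, X.Square x p t q ∧ X.Square y p t r ∧ X.Square z q t r := by
  classical
  have hx := hxy.2.2.1
  have hy := hyz.2.2.1
  have hz := hyz.2.2.2.2.2.1.symm
  have hl : X.IsLinkSimplex v (({x, y, z} : Finset V) : Set V) := by
    refine hX v {x, y, z} ?_ ?_
    · simp only [Finset.mem_insert, Finset.mem_singleton]
      rintro w (rfl | rfl | rfl) <;> assumption
    · simp only [Finset.mem_insert, Finset.mem_singleton]
      rintro w (rfl | rfl | rfl) w' (rfl | rfl | rfl) hne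
      · exact absurd rfl hne
      · exact hxy.isLinkSimplex
      · exact hxz.isLinkSimplex
      · exact hxy.reflect.isLinkSimplex
      · exact absurd rfl hne
      · exact hyz.isLinkSimplex
      · exact hxz.reflect.isLinkSimplex
      · exact hyz.reflect.isLinkSimplex
      · exact absurd rfl hne
  obtain ⟨c, hc, hv, hcap⟩ := hl
  have hmem : ∀ w ∈ (({x, y, z} : Finset V) : Set V), w ∈ c := fun w hw => by
    rw [← hcap] at hw; exact hw.1
  obtain ⟨n, f, hf, hr, hs⟩ := X.exists_chart c hc
  obtain ⟨u, rfl⟩ : v ∈ Set.range f := by rwa [hr]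
  obtain ⟨i, rfl⟩ := exists_toggle_of_adj hf hr hs (hmem _ (by simp)) hx
  obtain ⟨j, rfl⟩ := exists_toggle_of_adj hf hr hs (hmem _ (by simp)) hy
  obtain ⟨k, rfl⟩ := exists_toggle_of_adj hf hr hs (hmem _ (by simp)) hz
  have hij : i ≠ j := fun e => hxy.2.1 (by rw [e])
  have hik : i ≠ k := fun e => hxz.2.1 (by rw [e])
  have hjk : j ≠ k := fun e => hyz.2.1 (by rw [e])
  -- The given squares need not lie in the cube `c` a priori; uniqueness of the fourth corner puts
  -- them there.
  have hp := hxy.unique (square_toggle hf hr hs u hij)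
  have hq := hxz.unique (square_toggle hf hr hs u hik)
  have hrr := hyz.unique (square_toggle hf hr hs u hjk)
  subst hp hq hrr
  refine ⟨f (toggle (toggle (toggle u i) j) k), square_toggle hf hr hs _ hjk, ?_, ?_⟩
  · rw [toggle_comm u i j]
    exact square_toggle hf hr hs (toggle u j) hik
  · rw [toggle_comm u i k, toggle_comm u j k, toggle_comm (toggle u i) j k, toggle_comm u i k]
    exact square_toggle hf hr hs (toggle u k) hij

end CubeComplex

/-! ### Rewriting of edge paths and strips of squares -/

namespace CubeComplex

variable {V : Type*}

/-- Replacement, in a list of vertices, of two consecutive sides of a square by the other two. -/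
inductive Swap (X : CubeComplex V) : List V → List V → Prop
  | head {a b c d : V} (l : List V) (h : X.Square a b c d) : Swap X (a :: b :: c :: l) (a :: d :: c :: l)
  | cons (a : V) {l m : List V} (h : Swap X l m) : Swap X (a :: l) (a :: m)

/-- Removal of a backtrack from a list of vertices. -/
inductive Cancel : List V → List V → Prop
  | head (a b : V) (l : List V) : Cancel (a :: b :: a :: l) (a :: l)
  | cons (a : V) {l m : List V} (h : Cancel l m) : Cancel (a :: l) (a :: m)

/-- A swap or the removal of a backtrack. -/
def Step (X : CubeComplex V) (l m : List V) : Prop := X.Swap l m ∨ Cancel l m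

/-- `X.Del q r`: along the walk `q` there is a strip of squares, starting with some edge `s` at
the first vertex of `q`, and ending with an edge of `q`; replacing the part of `q` up to this
edge by the opposite side of the strip yields the walk `r`. -/
inductive Del (X : CubeComplex V) : List V → List V → Prop
  | here (x y : V) (l : List V) : Del X (x :: y :: l) (y :: l)
  | there {x x' y' y : V} {q r : List V} (h : X.Square x x' y' y) (hd : Del X (x' :: q) (y' :: r)) :
      Del X (x :: x' :: q) (y :: y' :: r)

/-- Deletion of a pair of edges dual to the ends of a strip of squares that runs along the
part of the walk between them. -/
inductive PairDel (X : CubeComplex V) : List V → List V → Prop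
  | head {a : V} {q r : List V} (h : X.Del q (a :: r)) : PairDel X (a :: q) (a :: r)
  | cons (a : V) {l m : List V} (h : PairDel X l m) : PairDel X (a :: l) (a :: m)

variable {X : CubeComplex V}

/-- Equivalence under swaps. -/
abbrev Swaps (X : CubeComplex V) : List V → List V → Prop := Relation.ReflTransGen X.Swap

/-- Reducibility by steps. -/
abbrev Steps (X : CubeComplex V) : List V → List V → Prop := Relation.ReflTransGen X.Step

theorem Swap.symm {l m : List V} (h : X.Swap l m) : X.Swap m l := by
  induction h with
  | head l h => exact .head l h.reflect
  | cons a _ ih => exact .cons a ih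

theorem Swaps.symm {l m : List V} (h : X.Swaps l m) : X.Swaps m l := by
  induction h with
  | refl => exact .refl
  | tail _ h ih => exact .head h.symm ih

theorem Swaps.cons (a : V) {l m : List V} (h : X.Swaps l m) : X.Swaps (a :: l) (a :: m) :=
  h.lift (List.cons a) fun _ _ => Swap.cons a

theorem Swaps.steps {l m : List V} (h : X.Swaps l m) : X.Steps l m := Relation.ReflTransGen.mono (fun _ _ => Or.inl) _ _ h

theorem Step.cons (a : V) {l m : List V} (h : X.Step l m) : X.Step (a :: l) (a :: m) :=
  h.imp (Swap.cons a) (Cancel.cons a)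

theorem Steps.cons (a : V) {l m : List V} (h : X.Steps l m) : X.Steps (a :: l) (a :: m) :=
  h.lift (List.cons a) fun _ _ => Step.cons a

theorem Swap.append_right {l m : List V} (h : X.Swap l m) (t : List V) :
    X.Swap (l ++ t) (m ++ t) := by
  induction h with
  | head l h => exact .head _ h
  | cons a _ ih => exact .cons a ih

theorem Cancel.append_right {l m : List V} (h : Cancel l m) (t : List V) :
    Cancel (l ++ t) (m ++ t) := by
  induction h with
  | head a b l => exact .head _ _ _
  | cons a _ ih => exact .cons a ih

theorem Step.append_right {l m : List V} (h : X.Step l m) (t : List V) :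
    X.Step (l ++ t) (m ++ t) := h.imp (fun h => h.append_right t) (fun h => h.append_right t)

theorem Step.append_left {l m : List V} (h : X.Step l m) (t : List V) :
    X.Step (t ++ l) (t ++ m) := by
  induction t with
  | nil => exact h
  | cons a _ ih => exact ih.cons a

theorem Swap.length_eq {l m : List V} (h : X.Swap l m) : m.length = l.length := by
  induction h with
  | head => rfl
  | cons a _ ih => simp [ih]

theorem Cancel.length_eq {l m : List V} (h : Cancel l m) : l.length = m.length + 2 := by
  induction h with
  | head => rfl
  | cons a _ ih => simp [ih]

theorem Swaps.length_eq {l m : List V} (h : X.Swaps l m) : m.length = l.length := by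
  induction h with
  | refl => rfl
  | tail _ h ih => rw [h.length_eq, ih]

theorem Steps.length_le {l m : List V} (h : X.Steps l m) : m.length ≤ l.length := by
  induction h with
  | refl => exact le_rfl
  | tail _ h ih =>
    rcases h with h | h
    · rwa [h.length_eq]
    · have := h.length_eq; omega

theorem Swap.head_eq {a : V} {l m : List V} (h : X.Swap (a :: l) m) : ∃ m', m = a :: m' := by
  cases h <;> exact ⟨_, rfl⟩

theorem Cancel.head_eq {a : V} {l m : List V} (h : Cancel (a :: l) m) : ∃ m', m = a :: m' := by
  cases h <;> exact ⟨_, rfl⟩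

theorem PairDel.head_eq {a : V} {l m : List V} (h : X.PairDel (a :: l) m) :
    ∃ m', m = a :: m' := by
  cases h <;> exact ⟨_, rfl⟩

/-- A square is determined by three of its vertices. -/
theorem Square.unique' {a b c d d' : V} (h : X.Square a b c d) (h' : X.Square a b c d') :
    d = d' :=
  h.badc.unique h'.badc

/-- If the swapped square lies under the interior of the strip, the 3-cube condition pushes two
squares of the strip across a cube. At the far end of the strip, the swap lengthens or shortens it
by one square and leaves `r` unchanged. -/
theorem Del.swap (hX : X.HasFlagLinks) {q r : List V} (h : X.Del q r) {q' : List V}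
    (hs : X.Swap q q') : ∃ r', X.Del q' r' ∧ (r = r' ∨ X.Swap r r') := by
  induction h generalizing q' with
  | here x y l =>
    cases hs with
    | head l hsq => exact ⟨_, .there hsq.adcb (.here _ _ _), Or.inl rfl⟩
    | cons _ hs =>
      obtain ⟨m, rfl⟩ := hs.head_eq
      exact ⟨_, .here _ _ _, Or.inr hs⟩
  | @there x x' y' y q r hsq hd ih =>
    cases hs with
    | @head _ _ c d l hsq' =>
      cases hd with
      | here =>
        obtain rfl := hsq.unique' hsq'
        exact ⟨_, .here _ _ _, Or.inl rfl⟩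
      | @there _ _ y3 _ _ _ hsq2 hd =>
        obtain ⟨t, h1, h2, h3⟩ := hX.exists_cube (v := x') (x := x) (y := y') (z := c)
          hsq.badc hsq'.badc hsq2.adcb
        exact ⟨_, .there h1.adcb (.there h3.badc hd), Or.inr (.head _ h2.badc)⟩
    | cons _ hs =>
      obtain ⟨m, rfl⟩ := hs.head_eq
      obtain ⟨r', hd', h⟩ := ih hs
      rcases h with rfl | h
      · exact ⟨_, .there hsq hd', Or.inl rfl⟩
      · obtain ⟨r'', rfl⟩ := h.head_eq
        exact ⟨_, .there hsq hd', Or.inr (.cons _ h)⟩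

theorem Del.slide {x : V} {q r : List V} (h : X.Del (x :: q) r) : X.Swaps (x :: q) (x :: r) := by
  generalize hp : x :: q = p at h
  induction h generalizing x q with
  | here x y l => cases hp; exact .refl
  | there hsq hd ih =>
    cases hp
    exact ((ih rfl).cons _).tail (.head _ hsq)

theorem Del.steps {a : V} {q r : List V} (h : X.Del q (a :: r)) : X.Steps (a :: q) (a :: r) := by
  obtain ⟨x, q, rfl⟩ : ∃ x q', q = x :: q' := by cases h <;> exact ⟨_, _, rfl⟩
  exact (h.slide.cons a).steps.tail (Or.inr (.head a x r))

theorem PairDel.steps {p r : List V} (h : X.PairDel p r) : X.Steps p r := by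
  induction h with
  | head h => exact h.steps
  | cons a _ ih => exact ih.cons a

theorem Cancel.pairDel {p r : List V} (h : Cancel p r) : X.PairDel p r := by
  induction h with
  | head a b l => exact .head (.here _ _ _)
  | cons a _ ih => exact .cons a ih

/-- Cancellation does not commute with swaps, since a swap can pull the two edges of a backtrack
apart. Deletion of the two ends of a strip is the closure of cancellation that does commute: a swap
at the start of the strip only adds or removes its first square. -/
theorem PairDel.swap (hX : X.HasFlagLinks) {p r : List V} (h : X.PairDel p r) {p' : List V}
    (hs : X.Swap p p') : ∃ r', X.PairDel p' r' ∧ (r = r' ∨ X.Swap r r') := by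
  induction h generalizing p' with
  | @head a q r h =>
    cases hs with
    | head l hsq =>
      cases h with
      | here => exact absurd rfl hsq.1
      | @there _ _ y' _ _ _ hsq' hd =>
        obtain rfl := hsq.bcda.unique hsq'
        exact ⟨_, .cons _ (.head hd), Or.inl rfl⟩
    | cons _ hs =>
      obtain ⟨r', hd, h⟩ := h.swap hX hs
      rcases h with rfl | h
      · exact ⟨_, .head hd, Or.inl rfl⟩
      · obtain ⟨r'', rfl⟩ := h.head_eq
        exact ⟨_, .head hd, Or.inr h⟩
  | @cons a l m h ih =>
    cases hs with
    | head l hsq =>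
      cases h with
      | head h => exact ⟨_, .head (.there hsq.adcb.bcda h), Or.inl rfl⟩
      | cons _ h =>
        obtain ⟨m, rfl⟩ := h.head_eq
        exact ⟨_, .cons _ (.cons _ h), Or.inr (.head _ hsq)⟩
    | cons _ hs =>
      obtain ⟨r', hd, h⟩ := ih hs
      exact ⟨_, .cons _ hd, h.imp (congrArg _) (.cons _)⟩

theorem PairDel.swaps (hX : X.HasFlagLinks) {p r : List V} (h : X.PairDel p r) {p' : List V}
    (hs : X.Swaps p p') : ∃ r', X.PairDel p' r' ∧ X.Swaps r r' := by
  induction hs with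
  | refl => exact ⟨r, h, .refl⟩
  | tail _ hs ih =>
    obtain ⟨r', hd, h⟩ := ih
    obtain ⟨r'', hd', h'⟩ := hd.swap hX hs
    refine ⟨r'', hd', ?_⟩
    rcases h' with rfl | h'
    · exact h
    · exact h.tail h'

/-- A backtrack under the strip gives two equal squares, so the strip is shortened and survives. If
instead the backtrack uses the edge that ends the strip, both results differ by pushing across the
rest of the strip. -/
theorem Del.cancel {y : V} {q r q' : List V} (h : X.Del q (y :: r)) (hc : Cancel q q') :
    (∃ r', X.Del q' (y :: r') ∧ Cancel (y :: r) (y :: r')) ∨ X.Swaps (y :: q') (y :: r) := by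
  generalize hp : y :: r = p at h
  induction h generalizing y r q' with
  | here x y l =>
    cases hp
    cases hc with
    | head => exact Or.inr .refl
    | cons _ hc =>
      obtain ⟨m, rfl⟩ := hc.head_eq
      exact Or.inl ⟨_, .here _ _ _, hc⟩
  | @there x x' y' y q r hsq hd ih =>
    cases hp
    cases hc with
    | head =>
      cases hd with
      | here => exact absurd rfl hsq.1
      | there hsq2 hd =>
        obtain rfl := hsq.badc.unique hsq2
        exact Or.inl ⟨_, hd, .head _ _ _⟩
    | cons _ hc =>
      obtain ⟨m, rfl⟩ := hc.head_eq
      rcases ih hc rfl with ⟨r', hd', hc'⟩ | h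
      · exact Or.inl ⟨_, .there hsq hd', .cons _ hc'⟩
      · exact Or.inr (.head (.head _ hsq.dabc) (h.cons _))

/-- Two lists of vertices with a common reduct. -/
def Joinable (X : CubeComplex V) (l m : List V) : Prop := ∃ t, X.Steps l t ∧ X.Steps m t

theorem PairDel.joinable {p r s : List V} (h : X.PairDel p r) (hc : Cancel p s) :
    X.Joinable r s := by
  induction h generalizing s with
  | @head a q r h =>
    cases hc with
    | head =>
      cases h with
      | here => exact ⟨_, .refl, .refl⟩
      | there hsq _ => exact absurd rfl hsq.2.1
    | cons _ hc =>
      rcases h.cancel hc with ⟨r', hd, hc'⟩ | h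
      · exact ⟨_, .single (Or.inr hc'), hd.steps⟩
      · exact ⟨_, .refl, h.steps⟩
  | @cons a l m h ih =>
    cases hc with
    | head =>
      cases h with
      | head h => exact ⟨_, h.slide.symm.steps, .refl⟩
      | cons _ h =>
        obtain ⟨m, rfl⟩ := h.head_eq
        exact ⟨_, .single (Or.inr (.head _ _ _)), h.steps⟩
    | cons _ hc =>
      obtain ⟨t, h1, h2⟩ := ih hc
      exact ⟨_, h1.cons a, h2.cons a⟩

theorem Steps.swaps_or_cancel {p r : List V} (h : X.Steps p r) :
    X.Swaps p r ∨ ∃ p' r', X.Swaps p p' ∧ Cancel p' r' ∧ X.Steps r' r := by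
  induction h using Relation.ReflTransGen.head_induction_on with
  | refl => exact Or.inl .refl
  | head h hs ih =>
    rcases h with h | h
    · rcases ih with ih | ⟨p', r', h1, h2, h3⟩
      · exact Or.inl (.head h ih)
      · exact Or.inr ⟨p', r', .head h h1, h2, h3⟩
    · exact Or.inr ⟨_, _, .refl, h, hs⟩

/-- Reduction of lists of vertices is confluent. -/
theorem Steps.confluent (hX : X.HasFlagLinks) {p r s : List V} (hr : X.Steps p r)
    (hs : X.Steps p s) : X.Joinable r s := by
  induction hn : p.length using Nat.strong_induction_on generalizing p r s with
  | _ n ih =>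
  rcases hr.swaps_or_cancel with h | ⟨p1, r1, hp1, hc1, hr1⟩
  · exact ⟨s, h.symm.steps.trans hs, .refl⟩
  rcases hs.swaps_or_cancel with h | ⟨p2, s1, hp2, hc2, hs1⟩
  · exact ⟨r, .refl, h.symm.steps.trans hr⟩
  -- The first cancellations of the two reductions happen at swap-equivalent lists; as a pair
  -- deletion, the one is transported to the list of the other. The induction hypothesis then
  -- applies twice, to lists shorter by two.
  obtain ⟨r1', hd, hr1'⟩ := (hc1.pairDel (X := X)).swaps hX (hp1.symm.trans hp2)
  obtain ⟨t, ht1, ht2⟩ := hd.joinable hc2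
  have l1 := hp1.length_eq
  have l2 := hp2.length_eq
  have l3 := hc1.length_eq
  have l4 := hc2.length_eq
  obtain ⟨t1, h1, h2⟩ := ih r1.length (by omega) hr1 (hr1'.steps.trans ht1) rfl
  obtain ⟨t2, h3, h4⟩ := ih s1.length (by omega) hs1 (ht2.trans h2) rfl
  exact ⟨t2, h1.trans h4, h3⟩

theorem joinable_of_eqvGen (hX : X.HasFlagLinks) {l m : List V}
    (h : Relation.EqvGen X.Step l m) : X.Joinable l m := by
  induction h with
  | rel _ _ h => exact ⟨_, .single h, .refl⟩
  | refl => exact ⟨_, .refl, .refl⟩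
  | symm _ _ _ ih => obtain ⟨t, h1, h2⟩ := ih; exact ⟨t, h2, h1⟩
  | trans _ _ _ _ _ ih1 ih2 =>
    obtain ⟨t, h1, h2⟩ := ih1
    obtain ⟨t', h3, h4⟩ := ih2
    obtain ⟨t'', h5, h6⟩ := h2.confluent hX h3
    exact ⟨t'', h1.trans h5, h4.trans h6⟩

/-- `X.Lad a b a' b' w`: a strip of squares along the walk `w` from `b` to `b'`, which starts
with the edge `a b` and ends with the edge `a' b'`. -/
inductive Lad (X : CubeComplex V) : V → V → V → V → List V → Prop
  | nil (a b : V) : Lad X a b a b [b]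
  | cons {a b a₁ b₁ a' b' : V} {w : List V} (h : X.Square a b b₁ a₁) (hl : Lad X a₁ b₁ a' b' w) :
      Lad X a b a' b' (b :: w)

theorem Lad.head_eq {a b a' b' c : V} {w : List V} (h : X.Lad a b a' b' (c :: w)) : b = c := by
  cases h <;> rfl

theorem Lad.exists_eq_cons {a b a' b' : V} {w : List V} (h : X.Lad a b a' b' w) :
    ∃ w', w = b :: w' := by
  cases h <;> exact ⟨_, rfl⟩

/-- Two consecutive squares of the strip and the swapped square share a corner; the 3-cube that they
span carries the strip to the other side. -/
theorem Lad.swap (hX : X.HasFlagLinks) {a b a' b' : V} {w w' : List V}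
    (h : X.Lad a b a' b' w) (hs : X.Swap w w') : X.Lad a b a' b' w' := by
  induction h generalizing w' with
  | nil => cases hs with
    | cons _ hs => cases hs
  | @cons a b a₁ b₁ a' b' w hsq hl ih =>
    cases hs with
    | head l hsq' =>
      cases hl with
      | @cons _ _ a₂ c' _ _ _ hsq2 hl =>
        obtain rfl := hl.head_eq
        obtain ⟨t, h1, h2, h3⟩ := hX.exists_cube hsq.cbad hsq'.badc hsq2.badc
        exact .cons h1.badc (.cons h3.cbad hl)
    | cons _ hs =>
      exact .cons hsq (ih hs)

theorem Lad.cancel {a b a' b' : V} {w w' : List V}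
    (h : X.Lad a b a' b' w) (hs : Cancel w w') : X.Lad a b a' b' w' := by
  induction h generalizing w' with
  | nil => cases hs with
    | cons _ hs => cases hs
  | @cons a b a₁ b₁ a' b' w hsq hl ih =>
    cases hs with
    | head x y l =>
      cases hl with
      | @cons _ _ a₂ c' _ _ _ hsq2 hl =>
        obtain rfl := hl.head_eq
        obtain rfl := hsq.dcba.unique' hsq2
        exact hl
    | cons _ hs =>
      exact .cons hsq (ih hs)

theorem Lad.steps (hX : X.HasFlagLinks) {a b a' b' : V} {w w' : List V}
    (h : X.Lad a b a' b' w) (hs : X.Steps w w') : X.Lad a b a' b' w' := by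
  induction hs with
  | refl => exact h
  | tail _ hs ih => exact hs.elim (fun hs => ih.swap hX hs) (fun hs => ih.cancel hs)

/-- The two vertices are opposite corners of the last square of the strip. -/
theorem Lad.ne {a b a' b' x y : V} {w : List V} (h : X.Lad a b a' b' (w ++ [x, y])) :
    a' ≠ x := by
  generalize hp : w ++ [x, y] = p at h
  induction h generalizing w with
  | nil => rcases w with _ | ⟨c, _ | ⟨d, w⟩⟩ <;> simp at hp
  | cons hsq hl ih =>
    rcases w with _ | ⟨c, w⟩
    · cases hl with
      | nil => cases hp; exact fun e => hsq.2.1 e.symm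
      | cons _ hl =>
        cases hl <;> simp at hp
    · simp only [List.cons_append, List.cons.injEq] at hp
      exact ih hp.2

theorem Lad.exists_del {a b a' b' : V} {w : List V} (h : X.Lad a b a' b' w) (l : List V) :
    ∃ r, X.Del (w ++ a' :: l) (a :: r) := by
  induction h with
  | nil => exact ⟨_, .here _ _ _⟩
  | cons hsq hl ih =>
    obtain ⟨r, hr⟩ := ih
    obtain ⟨w', rfl⟩ := hl.exists_eq_cons
    exact ⟨_, .there hsq.bcda hr⟩

end CubeComplex

/-! ### Walks, hyperplanes and separation -/

namespace CubeComplex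

variable {V : Type*} {X : CubeComplex V}

/-- `X.IsWalk u v l`: the list `l` consists of the vertices of a walk from `u` to `v`. -/
inductive IsWalk (X : CubeComplex V) : V → V → List V → Prop
  | nil (u : V) : IsWalk X u u [u]
  | cons {u v w : V} {l : List V} (h : X.graph.Adj u v) (hl : IsWalk X v w l) :
      IsWalk X u w (u :: l)

theorem isWalk_support {u v : V} (p : X.graph.Walk u v) : X.IsWalk u v p.support := by
  induction p with
  | nil => exact .nil _
  | cons h p ih => exact .cons h ih

theorem IsWalk.exists_walk {u v : V} {l : List V} (h : X.IsWalk u v l) :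
    ∃ p : X.graph.Walk u v, p.support = l := by
  induction h with
  | nil => exact ⟨.nil, rfl⟩
  | cons h _ ih => obtain ⟨p, rfl⟩ := ih; exact ⟨.cons h p, rfl⟩

theorem IsWalk.exists_eq_cons {u v : V} {l : List V} (h : X.IsWalk u v l) :
    ∃ l', l = u :: l' := by
  cases h <;> exact ⟨_, rfl⟩

theorem IsWalk.exists_eq_concat {u v : V} {l : List V} (h : X.IsWalk u v l) :
    ∃ l', l = l' ++ [v] := by
  induction h with
  | nil => exact ⟨[], rfl⟩
  | cons h _ ih => obtain ⟨l', rfl⟩ := ih; exact ⟨_ :: l', rfl⟩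

theorem IsWalk.head_eq {u v a : V} {l : List V} (h : X.IsWalk u v (a :: l)) : a = u := by
  cases h <;> rfl

theorem IsWalk.of_cons {u v a b : V} {l : List V} (h : X.IsWalk u v (a :: b :: l)) :
    X.graph.Adj a b ∧ X.IsWalk b v (b :: l) := by
  cases h with
  | cons h hl => obtain rfl := hl.head_eq; exact ⟨h, hl⟩

theorem IsWalk.append {u v w : V} {l m : List V} (h : X.IsWalk u v l)
    (h' : X.IsWalk v w (v :: m)) : X.IsWalk u w (l ++ m) := by
  induction h with
  | nil => exact h'
  | cons h _ ih => exact .cons h (ih h')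

theorem IsWalk.concat {u v w : V} {l : List V} (h : X.IsWalk u v l) (h' : X.graph.Adj v w) :
    X.IsWalk u w (l ++ [w]) := h.append (.cons h' (.nil w))

theorem IsWalk.split {u v x y : V} {l m : List V} (h : X.IsWalk u v (l ++ x :: y :: m)) :
    X.IsWalk u x (l ++ [x]) ∧ X.graph.Adj x y ∧ X.IsWalk y v (y :: m) := by
  induction l generalizing u with
  | nil =>
    obtain rfl := h.head_eq
    exact ⟨.nil _, h.of_cons⟩
  | cons a l ih =>
    rw [List.cons_append] at h
    generalize ht : l ++ x :: y :: m = t at h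
    cases h with
    | cons h hl =>
      subst ht
      obtain ⟨h1, h2, h3⟩ := ih hl
      exact ⟨.cons h h1, h2, h3⟩
    | nil => simp at ht

theorem IsWalk.swap {u v : V} {l m : List V} (h : X.IsWalk u v l) (hs : X.Swap l m) :
    X.IsWalk u v m := by
  induction hs generalizing u with
  | head l hsq =>
    obtain rfl := h.head_eq
    obtain ⟨_, h⟩ := h.of_cons
    obtain ⟨_, h⟩ := h.of_cons
    exact .cons hsq.2.2.2.2.2.1.symm (.cons hsq.2.2.2.2.1.symm h)
  | cons a hs ih =>
    cases h with
    | nil => cases hs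
    | cons h hl => exact .cons h (ih hl)

theorem IsWalk.cancel {u v : V} {l m : List V} (h : X.IsWalk u v l) (hs : Cancel l m) :
    X.IsWalk u v m := by
  induction hs generalizing u with
  | head a b l =>
    obtain rfl := h.head_eq
    exact h.of_cons.2.of_cons.2
  | cons a hs ih =>
    cases h with
    | nil => cases hs
    | cons h hl => exact .cons h (ih hl)

theorem IsWalk.steps {u v : V} {l m : List V} (h : X.IsWalk u v l) (hs : X.Steps l m) :
    X.IsWalk u v m := by
  induction hs with
  | refl => exact h
  | tail _ hs ih => exact hs.elim ih.swap ih.cancel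

theorem Lad.isWalk {a b a' b' : V} {w : List V} (h : X.Lad a b a' b' w) : X.IsWalk b b' w := by
  induction h with
  | nil => exact .nil _
  | cons hsq _ ih => exact .cons hsq.2.2.2.1 ih

theorem Homotopic.eqvGen {u v : V} {p q : X.graph.Walk u v} (h : X.Homotopic p q) :
    Relation.EqvGen X.Step p.support q.support := by
  induction h with
  | refl p => exact .refl _
  | symm _ ih => exact .symm _ _ ih
  | trans _ _ ih1 ih2 => exact .trans _ _ _ ih1 ih2
  | backtrack p h q =>
    rw [SimpleGraph.Walk.support_append_eq_support_dropLast_append,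
      SimpleGraph.Walk.support_append_eq_support_dropLast_append]
    refine .rel _ _ (Step.append_left (Or.inr ?_) _)
    simp only [SimpleGraph.Walk.support_cons]
    rw [← SimpleGraph.Walk.cons_tail_support]
    exact .head _ _ _
  | square p q hab hbc had hdc hsq =>
    rw [SimpleGraph.Walk.support_append_eq_support_dropLast_append,
      SimpleGraph.Walk.support_append_eq_support_dropLast_append]
    refine .rel _ _ (Step.append_left (Or.inl ?_) _)
    simp only [SimpleGraph.Walk.support_cons]
    rw [← SimpleGraph.Walk.cons_tail_support]
    exact .head _ hsq

theorem eqvGen_append_right {l m : List V} (h : Relation.EqvGen X.Step l m) (t : List V) :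
    Relation.EqvGen X.Step (l ++ t) (m ++ t) := by
  induction h with
  | rel _ _ h => exact .rel _ _ (h.append_right t)
  | refl => exact .refl _
  | symm _ _ _ ih => exact .symm _ _ ih
  | trans _ _ _ _ _ ih1 ih2 => exact .trans _ _ _ ih1 ih2

theorem eqvGen_append_left {l m : List V} (h : Relation.EqvGen X.Step l m) (t : List V) :
    Relation.EqvGen X.Step (t ++ l) (t ++ m) := by
  induction h with
  | rel _ _ h => exact .rel _ _ (h.append_left t)
  | refl => exact .refl _
  | symm _ _ _ ih => exact .symm _ _ ih
  | trans _ _ _ _ _ ih1 ih2 => exact .trans _ _ _ ih1 ih2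

/-- In a simply connected complex, walks with the same endpoints are homotopic. -/
theorem IsSimplyConnected.eqvGen (hX : X.IsSimplyConnected) {u v : V} {l m : List V}
    (hl : X.IsWalk u v l) (hm : X.IsWalk u v m) : Relation.EqvGen X.Step l m := by
  obtain ⟨p, rfl⟩ := hl.exists_walk
  obtain ⟨q, rfl⟩ := hm.exists_walk
  -- Both `p` and `q` are compared with `p`, followed by the reverse of `q`, followed by `q`.
  have h1 := eqvGen_append_right (hX.2 u (p.append q.reverse)).eqvGen q.support.tail
  have h2 := eqvGen_append_left (hX.2 v (q.reverse.append q)).eqvGen p.support.dropLast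
  rw [← SimpleGraph.Walk.support_append, ← SimpleGraph.Walk.support_append] at h1
  rw [← SimpleGraph.Walk.support_append_eq_support_dropLast_append,
    ← SimpleGraph.Walk.support_append_eq_support_dropLast_append,
    SimpleGraph.Walk.append_assoc] at h2
  simp only [SimpleGraph.Walk.append_nil, SimpleGraph.Walk.nil_append] at h1 h2
  exact .trans _ _ _ (.symm _ _ h2) h1

theorem exists_geodesic (hX : X.IsSimplyConnected) (u v : V) :
    ∃ l, X.IsWalk u v l ∧ l.length = X.graph.dist u v + 1 := by
  obtain ⟨p, hp⟩ := hX.1.exists_walk_length_eq_dist u v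
  exact ⟨_, isWalk_support p, by rw [SimpleGraph.Walk.length_support, hp]⟩

theorem IsWalk.dist_lt {u v : V} {l : List V} (h : X.IsWalk u v l) :
    X.graph.dist u v < l.length := by
  obtain ⟨p, rfl⟩ := h.exists_walk
  have := SimpleGraph.dist_le p
  rw [SimpleGraph.Walk.length_support]
  omega

/-- A list of vertices that cannot be shortened by steps. -/
def Reduced (X : CubeComplex V) (l : List V) : Prop := ∀ m, X.Steps l m → m.length = l.length

theorem IsWalk.reduced_of_length {u v : V} {l : List V} (h : X.IsWalk u v l)
    (hl : l.length = X.graph.dist u v + 1) : X.Reduced l := by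
  intro m hm
  have h1 := hm.length_le
  have h2 := (h.steps hm).dist_lt
  omega

theorem Reduced.swaps {l m : List V} (h : X.Reduced l) (hm : X.Steps l m) : X.Swaps l m := by
  rcases hm.swaps_or_cancel with hs | ⟨p, r, h1, h2, -⟩
  · exact hs
  · have h3 := h1.length_eq
    have h4 := h2.length_eq
    have h5 := h r (h1.steps.tail (Or.inr h2))
    omega

theorem Reduced.of_append_left {l m : List V} (h : X.Reduced (l ++ m)) : X.Reduced l := by
  intro t ht
  have := h (t ++ m) (ht.lift (· ++ m) fun _ _ hs => hs.append_right m)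
  simpa using this

theorem Reduced.of_cons {a : V} {l : List V} (h : X.Reduced (a :: l)) : X.Reduced l := by
  intro t ht
  simpa using h (a :: t) (ht.cons a)

/-- Strips of squares extend along all reduced walks with the same endpoints. -/
theorem Lad.of_reduced (hX : X.IsCAT0) {a b a' b' : V} {w w' : List V}
    (h : X.Lad a b a' b' w) (hw : X.IsWalk b b' w') (hr : X.Reduced w') :
    X.Lad a b a' b' w' := by
  obtain ⟨t, h1, h2⟩ := joinable_of_eqvGen hX.2 (hX.1.eqvGen h.isWalk hw)
  exact h.steps hX.2 (h1.trans (hr.swaps h2).symm.steps)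

/-- Parallelism lifts to oriented edges, where a chain of squares is a strip. The orientation with
which it arrives is not controlled, hence the alternative. -/
theorem exists_lad_of_eqvGen {e f : Sym2 V} (h : Relation.EqvGen X.Opposite e f) {a b c d : V}
    (he : e = s(a, b)) (hf : f = s(c, d)) :
    (∃ w, X.Lad a b c d w) ∨ ∃ w, X.Lad a b d c w := by
  let R : V × V → V × V → Prop := fun p q => X.Square p.1 p.2 q.2 q.1
  have hR : ∀ {p q}, Relation.ReflTransGen R p q → Relation.ReflTransGen R q p := by
    intro p q h
    induction h with
    | refl => exact .refl
    | tail _ h ih => exact .head (Square.dcba h) ih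
  have hR' : ∀ {p q}, Relation.ReflTransGen R p q →
      Relation.ReflTransGen R p.swap q.swap := by
    intro p q h
    induction h with
    | refl => exact .refl
    | tail _ h ih => exact ih.tail (Square.badc h)
  have key : e = f ∨ ∃ p q : V × V, e = s(p.1, p.2) ∧ f = s(q.1, q.2) ∧
      Relation.ReflTransGen R p q := by
    clear he hf
    induction h with
    | rel _ _ h =>
      obtain ⟨a, b, c, d, hsq, rfl, rfl⟩ := h
      exact Or.inr ⟨(a, b), (d, c), rfl, rfl, .single hsq⟩
    | refl => exact Or.inl rfl
    | symm _ _ _ ih =>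
      rcases ih with h | ⟨p, q, h1, h2, h⟩
      · exact Or.inl h.symm
      · exact Or.inr ⟨q, p, h2, h1, hR h⟩
    | trans _ _ _ _ _ ih1 ih2 =>
      rcases ih1 with rfl | ⟨p, q, h1, h2, h⟩
      · exact ih2
      rcases ih2 with rfl | ⟨p', q', h1', h2', h'⟩
      · exact Or.inr ⟨p, q, h1, h2, h⟩
      · rw [h2, Sym2.eq_iff] at h1'
        rcases h1' with ⟨e1, e2⟩ | ⟨e1, e2⟩
        · obtain rfl : q = p' := Prod.ext e1 e2
          exact Or.inr ⟨p, q', h1, h2', h.trans h'⟩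
        · obtain rfl : q.swap = p' := Prod.ext e2 e1
          refine Or.inr ⟨p, q'.swap, h1, ?_, h.trans (by simpa using hR' h')⟩
          rw [h2']; exact Sym2.eq_swap
  have lad : ∀ {p q}, Relation.ReflTransGen R p q → ∃ w, X.Lad p.1 p.2 q.1 q.2 w := by
    intro p q h
    induction h using Relation.ReflTransGen.head_induction_on with
    | refl => exact ⟨_, .nil _ _⟩
    | head h _ ih => obtain ⟨w, hw⟩ := ih; exact ⟨_, .cons h hw⟩
  subst he hf
  rcases key with h | ⟨⟨p1, p2⟩, ⟨q1, q2⟩, h1, h2, h⟩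
  · rw [Sym2.eq_iff] at h
    rcases h with ⟨rfl, rfl⟩ | ⟨rfl, rfl⟩
    · exact Or.inl ⟨_, .nil _ _⟩
    · exact Or.inr ⟨_, .nil _ _⟩
  · have h' := hR' h
    simp only [Sym2.eq_iff] at h1 h2
    rcases h1 with ⟨rfl, rfl⟩ | ⟨rfl, rfl⟩ <;> rcases h2 with ⟨rfl, rfl⟩ | ⟨rfl, rfl⟩
    · exact Or.inl (lad h)
    · exact Or.inr (lad h)
    · exact Or.inr (lad h')
    · exact Or.inl (lad h')

theorem exists_hyperplane {u v : V} (h : X.graph.Adj u v) : ∃ Λ ∈ X.hyperplanes, s(u, v) ∈ Λ :=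
  ⟨_, ⟨s(u, v), h, rfl⟩, .refl _⟩

theorem eqvGen_of_mem_hyperplane {Λ : Set (Sym2 V)} (hΛ : Λ ∈ X.hyperplanes) {e f : Sym2 V}
    (he : e ∈ Λ) (hf : f ∈ Λ) : Relation.EqvGen X.Opposite e f := by
  obtain ⟨e₀, -, rfl⟩ := hΛ
  exact .trans _ _ _ (.symm _ _ he) hf

theorem mem_hyperplane_of_eqvGen {Λ : Set (Sym2 V)} (hΛ : Λ ∈ X.hyperplanes) {e f : Sym2 V}
    (h : Relation.EqvGen X.Opposite e f) (he : e ∈ Λ) : f ∈ Λ := by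
  obtain ⟨e₀, -, rfl⟩ := hΛ
  exact .trans _ _ _ he h

theorem hyperplane_eq {Λ Λ' : Set (Sym2 V)} (hΛ : Λ ∈ X.hyperplanes) (hΛ' : Λ' ∈ X.hyperplanes)
    {e : Sym2 V} (he : e ∈ Λ) (he' : e ∈ Λ') : Λ = Λ' := by
  ext f
  exact ⟨fun hf => mem_hyperplane_of_eqvGen hΛ' (eqvGen_of_mem_hyperplane hΛ he hf) he',
    fun hf => mem_hyperplane_of_eqvGen hΛ (eqvGen_of_mem_hyperplane hΛ' he' hf) he⟩

theorem Square.mem_hyperplane_iff {Λ : Set (Sym2 V)} (hΛ : Λ ∈ X.hyperplanes) {a b c d : V}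
    (h : X.Square a b c d) : s(a, b) ∈ Λ ↔ s(d, c) ∈ Λ := by
  have h' : Relation.EqvGen X.Opposite s(a, b) s(d, c) := .rel _ _ ⟨a, b, c, d, h, rfl, rfl⟩
  exact ⟨mem_hyperplane_of_eqvGen hΛ h', mem_hyperplane_of_eqvGen hΛ (.symm _ _ h')⟩

theorem adj_of_mem_hyperplane {Λ : Set (Sym2 V)} (hΛ : Λ ∈ X.hyperplanes) {a b : V}
    (h : s(a, b) ∈ Λ) : X.graph.Adj a b := by
  obtain ⟨e, he, rfl⟩ := hΛ
  have key : ∀ e f : Sym2 V, Relation.EqvGen X.Opposite e f →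
      (e ∈ X.graph.edgeSet ↔ f ∈ X.graph.edgeSet) := by
    intro e f h
    induction h with
    | rel _ _ h =>
      obtain ⟨a, b, c, d, hsq, rfl, rfl⟩ := h
      exact ⟨fun _ => hsq.2.2.2.2.1.symm, fun _ => hsq.2.2.1⟩
    | refl => exact Iff.rfl
    | symm _ _ _ ih => exact ih.symm
    | trans _ _ _ _ _ ih1 ih2 => exact ih1.trans ih2
  exact (key _ _ h).1 he

open Classical in
/-- The number of times that a walk crosses the hyperplane `Λ`. -/
noncomputable def cross (Λ : Set (Sym2 V)) : List V → ℕ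
  | [] => 0
  | [_] => 0
  | a :: b :: l => (if s(a, b) ∈ Λ then 1 else 0) + cross Λ (b :: l)

theorem cross_cons_of_mem {Λ : Set (Sym2 V)} {a b : V} {l : List V} (h : s(a, b) ∈ Λ) :
    cross Λ (a :: b :: l) = 1 + cross Λ (b :: l) := by simp [cross, h]

theorem cross_cons_of_notMem {Λ : Set (Sym2 V)} {a b : V} {l : List V} (h : s(a, b) ∉ Λ) :
    cross Λ (a :: b :: l) = cross Λ (b :: l) := by simp [cross, h]

theorem cross_append (Λ : Set (Sym2 V)) (l m : List V) (v : V) :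
    cross Λ (l ++ v :: m) = cross Λ (l ++ [v]) + cross Λ (v :: m) := by
  induction l with
  | nil => simp [cross]
  | cons a l ih =>
    rcases l with _ | ⟨b, l⟩
    · simp [cross]
    · simp only [List.cons_append, cross] at ih ⊢
      omega

theorem Swap.cross_eq {Λ : Set (Sym2 V)} (hΛ : Λ ∈ X.hyperplanes) {l m : List V}
    (h : X.Swap l m) : cross Λ m = cross Λ l := by
  induction h with
  | @head a b c d l h =>
    have h1 := (h.mem_hyperplane_iff hΛ).symm
    have h2 := (h.bcda.mem_hyperplane_iff hΛ).symm
    by_cases ha : s(a, b) ∈ Λ <;> by_cases hb : s(b, c) ∈ Λ <;>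
      simp [cross, h1, h2, ha, hb]
  | cons a h ih =>
    rename_i l m
    rcases l with _ | ⟨b, l⟩
    · cases h
    · obtain ⟨m, rfl⟩ := h.head_eq
      simp only [cross, ih]

theorem Cancel.cross_eq (Λ : Set (Sym2 V)) {l m : List V}
    (h : Cancel l m) : cross Λ l = cross Λ m ∨ cross Λ l = cross Λ m + 2 := by
  induction h with
  | head a b l =>
    have : s(b, a) = s(a, b) := Sym2.eq_swap
    by_cases h : s(a, b) ∈ Λ
    · right; simp [cross, this, h]; omega
    · left; simp [cross, this, h]
  | cons a h ih =>
    rename_i l m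
    rcases l with _ | ⟨b, l⟩
    · cases h
    · obtain ⟨m, rfl⟩ := h.head_eq
      simp only [cross]
      omega

theorem Cancel.exists_two_le_cross {u v : V} {l m : List V} (hl : X.IsWalk u v l)
    (h : Cancel l m) : ∃ Λ ∈ X.hyperplanes, 2 ≤ cross Λ l := by
  induction h generalizing u with
  | head a b l =>
    obtain ⟨Λ, hΛ, h⟩ := exists_hyperplane hl.of_cons.1
    have : s(b, a) = s(a, b) := Sym2.eq_swap
    refine ⟨Λ, hΛ, ?_⟩
    simp only [cross, this, h, if_true]
    omega
  | cons a h ih =>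
    rename_i l m
    rcases l with _ | ⟨b, l⟩
    · cases h
    · obtain ⟨Λ, hΛ, h⟩ := ih hl.of_cons.2
      refine ⟨Λ, hΛ, ?_⟩
      simp only [cross]
      omega

theorem exists_first_crossing {Λ : Set (Sym2 V)} {l : List V} (h : cross Λ l ≠ 0) :
    ∃ l₁ x y l₂, l = l₁ ++ x :: y :: l₂ ∧ s(x, y) ∈ Λ ∧ cross Λ (l₁ ++ [x]) = 0 := by
  induction l with
  | nil => simp [cross] at h
  | cons a l ih =>
    rcases l with _ | ⟨b, l⟩
    · simp [cross] at h
    · by_cases hab : s(a, b) ∈ Λ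
      · exact ⟨[], a, b, l, rfl, hab, rfl⟩
      · rw [cross_cons_of_notMem hab] at h
        obtain ⟨l₁, x, y, l₂, h1, h2, h3⟩ := ih h
        refine ⟨a :: l₁, x, y, l₂, by rw [h1]; rfl, h2, ?_⟩
        rcases l₁ with _ | ⟨c, l₁⟩
        · simp only [List.nil_append, List.cons.injEq] at h1
          obtain ⟨rfl, rfl⟩ := h1
          simpa [cross] using hab
        · simp only [List.cons_append, List.cons.injEq] at h1
          obtain ⟨rfl, rfl⟩ := h1
          rw [List.cons_append, List.cons_append, cross_cons_of_notMem hab]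
          exact h3

/-- A strip of squares joins an edge at the beginning of a reduced walk to the last edge of
the walk, provided they are dual to the same hyperplane. -/
theorem lad_of_mem_hyperplane (hX : X.IsCAT0) {Λ : Set (Sym2 V)} (hΛ : Λ ∈ X.hyperplanes)
    {a b x y : V} {w : List V} (hw : X.IsWalk b x w) (hxy : s(x, y) ∈ Λ)
    (hr : X.Reduced (w ++ [y])) (hab : s(a, b) ∈ Λ) : X.Lad a b y x w := by
  rcases exists_lad_of_eqvGen (eqvGen_of_mem_hyperplane hΛ hab hxy) rfl rfl with
    ⟨w', h⟩ | ⟨w', h⟩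
  · have h' := h.of_reduced hX (hw.concat (adj_of_mem_hyperplane hΛ hxy)) hr
    obtain ⟨w₁, rfl⟩ := hw.exists_eq_concat
    rw [List.append_assoc] at h'
    -- With this orientation the strip would run along the whole of `w ++ [y]` and have the last
    -- edge of that walk as its final rung.
    exact absurd rfl h'.ne
  · exact h.of_reduced hX hw hr.of_append_left

theorem Del.length_eq {q r : List V} (h : X.Del q r) : q.length = r.length + 1 := by
  induction h with
  | here => rfl
  | there _ _ ih => simpa using ih

/-- Between two consecutive crossings of `Λ` a strip of squares runs along the walk, and deleting
its two ends shortens the walk by two. -/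
theorem Reduced.cross_le_one (hX : X.IsCAT0) {Λ : Set (Sym2 V)} (hΛ : Λ ∈ X.hyperplanes)
    {u v : V} {l : List V} (hl : X.IsWalk u v l) (hr : X.Reduced l) : cross Λ l ≤ 1 := by
  induction hl with
  | nil => simp [cross]
  | @cons a b v l hab hl ih =>
    have ih := ih hr.of_cons
    obtain ⟨l', rfl⟩ := hl.exists_eq_cons
    by_cases h : s(a, b) ∈ Λ
    · rw [cross_cons_of_mem h]
      by_contra hne
      obtain ⟨l₁, x, y, l₂, h1, h2, -⟩ := exists_first_crossing (l := b :: l') (Λ := Λ) (by omega)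
      rw [h1] at hl hr
      have hr' : X.Reduced (l₁ ++ [x] ++ [y]) := by
        refine Reduced.of_append_left (m := l₂) ?_
        simpa using hr.of_cons
      have hlad := lad_of_mem_hyperplane hX hΛ hl.split.1 h2 hr' h
      obtain ⟨r, hd⟩ := hlad.exists_del l₂
      have h3 := hd.length_eq
      simp only [List.append_assoc, List.cons_append, List.nil_append] at hd
      have h4 := hr _ hd.steps
      simp at h3 h4
      omega
    · rwa [cross_cons_of_notMem h]

theorem Swaps.cross_eq {Λ : Set (Sym2 V)} (hΛ : Λ ∈ X.hyperplanes) {l m : List V}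
    (h : X.Swaps l m) : cross Λ m = cross Λ l := by
  induction h with
  | refl => rfl
  | tail _ h ih => rw [h.cross_eq hΛ, ih]

/-- Shortening requires a backtrack after some swaps. A backtrack crosses a hyperplane twice, and
swaps preserve the number of crossings. -/
theorem IsWalk.reduced_of_cross {u v : V} {l : List V} (hl : X.IsWalk u v l)
    (h : ∀ Λ ∈ X.hyperplanes, cross Λ l ≤ 1) : X.Reduced l := by
  intro m hm
  rcases hm.swaps_or_cancel with hs | ⟨p, r, h1, h2, -⟩
  · exact hs.length_eq
  · obtain ⟨Λ, hΛ, h3⟩ := h2.exists_two_le_cross (hl.steps h1.steps)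
    have := h Λ hΛ
    rw [h1.cross_eq hΛ] at h3
    omega

theorem odd_cross_iff_of_eqvGen {Λ : Set (Sym2 V)} (hΛ : Λ ∈ X.hyperplanes) {l m : List V}
    (h : Relation.EqvGen X.Step l m) : Odd (cross Λ l) ↔ Odd (cross Λ m) := by
  induction h with
  | rel _ _ h =>
    rcases h with h | h
    · rw [h.cross_eq hΛ]
    · rcases h.cross_eq Λ with h | h <;> rw [h]
      simp [Nat.odd_add]
  | refl => exact Iff.rfl
  | symm _ _ _ ih => exact ih.symm
  | trans _ _ _ _ _ ih1 ih2 => exact ih1.trans ih2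

/-- The hyperplane `Λ` separates the vertices `u` and `v`. -/
def Sep (X : CubeComplex V) (Λ : Set (Sym2 V)) (u v : V) : Prop :=
  ∃ l, X.IsWalk u v l ∧ Odd (cross Λ l)

/-- Any two walks between the same vertices are related by steps, which preserve the parity of
crossings; so one walk decides. -/
theorem sep_iff (hX : X.IsCAT0) {Λ : Set (Sym2 V)} (hΛ : Λ ∈ X.hyperplanes) {u v : V}
    {l : List V} (hl : X.IsWalk u v l) : X.Sep Λ u v ↔ Odd (cross Λ l) :=
  ⟨fun ⟨_, hm, h⟩ => (odd_cross_iff_of_eqvGen hΛ (hX.1.eqvGen hm hl)).1 h, fun h => ⟨l, hl, h⟩⟩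

theorem sep_adj (hX : X.IsCAT0) {Λ : Set (Sym2 V)} (hΛ : Λ ∈ X.hyperplanes) {u v : V}
    (h : X.graph.Adj u v) : X.Sep Λ u v ↔ s(u, v) ∈ Λ := by
  rw [sep_iff hX hΛ (.cons h (.nil v))]
  by_cases h : s(u, v) ∈ Λ <;> simp [cross, h]

theorem sep_self (hX : X.IsCAT0) {Λ : Set (Sym2 V)} (hΛ : Λ ∈ X.hyperplanes) (u : V) :
    ¬ X.Sep Λ u u := by
  rw [sep_iff hX hΛ (.nil u)]
  simp [cross]

theorem sep_trans_iff (hX : X.IsCAT0) {Λ : Set (Sym2 V)} (hΛ : Λ ∈ X.hyperplanes) (u v w : V) :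
    X.Sep Λ u w ↔ ¬ (X.Sep Λ u v ↔ X.Sep Λ v w) := by
  obtain ⟨l, hl, -⟩ := exists_geodesic hX.1 u v
  obtain ⟨m, hm, -⟩ := exists_geodesic hX.1 v w
  obtain ⟨m, rfl⟩ := hm.exists_eq_cons
  rw [sep_iff hX hΛ hl, sep_iff hX hΛ hm, sep_iff hX hΛ (hl.append hm)]
  obtain ⟨l, rfl⟩ := hl.exists_eq_concat
  rw [List.append_assoc, List.singleton_append, cross_append]
  rw [Nat.odd_add, ← Nat.not_odd_iff_even]
  tauto

theorem sep_comm (hX : X.IsCAT0) {Λ : Set (Sym2 V)} (hΛ : Λ ∈ X.hyperplanes) {u v : V} :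
    X.Sep Λ u v ↔ X.Sep Λ v u := by
  have h1 := sep_trans_iff hX hΛ u v u
  have h2 := sep_self hX hΛ u
  tauto

/-- Two crossing hyperplanes that are dual to edges at the same vertex intersect in a square at
this vertex. -/
theorem exists_square (hX : X.IsCAT0) {Λ Λ' : Set (Sym2 V)} (hΛ : Λ ∈ X.hyperplanes)
    (hΛ' : Λ' ∈ X.hyperplanes) (hne : Λ ≠ Λ') {p q q' z : V} (h : s(p, q) ∈ Λ)
    (h' : s(p, q') ∈ Λ') (hz : X.Sep Λ p z) (hz' : X.Sep Λ' p z) :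
    ∃ w, X.Square p q w q' := by
  have hpq := adj_of_mem_hyperplane hΛ h
  have hpq' : s(p, q) ∉ Λ' := fun h' => hne (hyperplane_eq hΛ hΛ' h h')
  obtain ⟨l, hl, hlen⟩ := exists_geodesic hX.1 q z
  have hr := hl.reduced_of_length hlen
  have h0 : cross Λ l = 0 := by
    have h1 := hr.cross_le_one hX hΛ hl
    have h2 := sep_trans_iff hX hΛ p q z
    rw [sep_adj hX hΛ hpq, sep_iff hX hΛ hl] at h2
    have h3 : ¬ Odd (cross Λ l) := by tauto
    interval_cases hc : cross Λ l
    · rfl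
    · exact absurd odd_one h3
  have h1 : cross Λ' l ≠ 0 := by
    have h2 := sep_trans_iff hX hΛ' p q z
    rw [sep_adj hX hΛ' hpq, sep_iff hX hΛ' hl] at h2
    have h3 : Odd (cross Λ' l) := by tauto
    intro h0
    simp [h0] at h3
  obtain ⟨l₁, x, y, l₂, rfl, hxy, h2⟩ := exists_first_crossing h1
  obtain ⟨hl1, hadj, hl2⟩ := hl.split
  have hw : X.IsWalk p x (p :: (l₁ ++ [x])) := .cons hpq hl1
  obtain ⟨m, hm⟩ := hl1.exists_eq_cons
  -- The walk from `p` through `q` up to the first crossing of `Λ'` carries a strip that starts with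
  -- the edge `q' p`; its first square is the one wanted.
  have hlad := lad_of_mem_hyperplane hX hΛ' (a := q') hw hxy ?_ (Sym2.eq_swap ▸ h')
  · rw [hm] at hlad
    cases hlad with
    | cons hsq hl =>
      obtain rfl := hl.head_eq
      exact ⟨_, hsq.bcda⟩
  · refine (hw.concat hadj).reduced_of_cross fun Λ₁ hΛ₁ => ?_
    have h3 := hr.cross_le_one hX hΛ₁ hl
    have h4 : l₁ ++ x :: y :: l₂ = (l₁ ++ [x]) ++ y :: l₂ := by simp
    rw [h4, cross_append] at h3 h0
    rw [List.cons_append]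
    rw [hm] at h3 h0 ⊢
    by_cases h5 : s(p, q) ∈ Λ₁
    · obtain rfl := hyperplane_eq hΛ hΛ₁ h h5
      rw [List.cons_append, cross_cons_of_mem h5]
      rw [List.cons_append] at h0
      omega
    · rw [List.cons_append, cross_cons_of_notMem h5]
      rw [List.cons_append] at h3
      omega

/-- If no edge at `x` is dual to `Λ`, then some hyperplane separates `x` from `Λ`. -/
theorem exists_halfspace_ssubset (hX : X.IsCAT0) {Λ : Set (Sym2 V)} (hΛ : Λ ∈ X.hyperplanes)
    {x : V} (hx : ∀ y, s(x, y) ∉ Λ) : ∃ Λ' ∈ X.hyperplanes,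
      {z | ¬ X.Sep Λ' x z} ⊂ {z | ¬ X.Sep Λ x z} := by
  classical
  have hex : ∃ n p q, s(p, q) ∈ Λ ∧ ¬ X.Sep Λ x p ∧ X.graph.dist p x = n := by
    obtain ⟨e, he, h⟩ := hΛ
    have he' : e ∈ Λ := by rw [h]; exact .refl _
    have hΛ : Λ ∈ X.hyperplanes := ⟨e, he, h⟩
    induction e using Sym2.ind with
    | _ p q =>
    by_cases hp : X.Sep Λ x p
    · have h1 := sep_trans_iff hX hΛ x p q
      rw [sep_adj hX hΛ he] at h1
      exact ⟨_, q, p, Sym2.eq_swap ▸ he', by tauto, rfl⟩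
    · exact ⟨_, p, q, he', hp, rfl⟩
  -- Among the edges of `Λ`, take one whose endpoint `p` on the side of `x` is nearest to `x`. The
  -- new hyperplane is dual to the first edge of a geodesic from `p` to `x`.
  obtain ⟨p, q, hpq, hp, hd⟩ := Nat.find_spec hex
  have hmin := fun m (h : m < Nat.find hex) => Nat.find_min hex h
  rw [← hd] at hmin
  obtain ⟨l, hl, hlen⟩ := exists_geodesic hX.1 p x
  have hr := hl.reduced_of_length hlen
  cases hl with
  | nil => exact absurd hpq (hx q)
  | @cons _ p₁ _ l hpp₁ hl₁ =>
  have hlt : X.graph.dist p₁ x < X.graph.dist p x := by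
    have := hl₁.dist_lt
    simp at hlen
    omega
  obtain ⟨Λ', hΛ', hmem⟩ := exists_hyperplane hpp₁
  obtain ⟨l, rfl⟩ := hl₁.exists_eq_cons
  have hsep : ∀ {Λ}, Λ ∈ X.hyperplanes → s(p, p₁) ∈ Λ → X.Sep Λ p x := by
    intro Λ hΛ h
    have hle := hr.cross_le_one hX hΛ (.cons hpp₁ hl₁)
    rw [sep_iff hX hΛ (.cons hpp₁ hl₁)]
    rw [cross_cons_of_mem h] at hle ⊢
    obtain h0 : cross Λ (p₁ :: l) = 0 := by omega
    simp [h0]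
  have hne : Λ ≠ Λ' := by
    rintro rfl
    exact hp ((sep_comm hX hΛ).1 (hsep hΛ hmem))
  have hp' := hsep hΛ' hmem
  refine ⟨Λ', hΛ', fun z hz => ?_, fun hsub => hsub (a := p) hp ((sep_comm hX hΛ').1 hp')⟩
  intro hxz
  have h1 : X.Sep Λ p z := by
    have := sep_trans_iff hX hΛ x p z
    tauto
  have h2 : X.Sep Λ' p z := by
    have := sep_trans_iff hX hΛ' p x z
    have hz : ¬ X.Sep Λ' x z := hz
    tauto
  -- If the halfspaces were not nested, the two hyperplanes would cross in a square at `p`. Its side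
  -- at `p₁` is dual to `Λ`, and `p₁` is nearer to `x` than `p`.
  obtain ⟨w, hsq⟩ := exists_square hX hΛ hΛ' hne hpq hmem h1 h2
  refine hmin _ hlt ⟨p₁, w, ?_, ?_, rfl⟩
  · exact (hsq.mem_hyperplane_iff hΛ).1 hpq
  · have h3 := sep_trans_iff hX hΛ x p p₁
    rw [sep_adj hX hΛ hpp₁] at h3
    have h4 : s(p, p₁) ∉ Λ := fun h => hne (hyperplane_eq hΛ hΛ' h hmem)
    tauto

/-- The hyperplane dual to the first edge of a geodesic is crossed exactly once, hence separates its
endpoints. -/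
theorem eq_of_forall_not_sep (hX : X.IsCAT0) {x y : V}
    (h : ∀ Λ ∈ X.hyperplanes, ¬ X.Sep Λ x y) : x = y := by
  obtain ⟨l, hl, hlen⟩ := exists_geodesic hX.1 x y
  have hr := hl.reduced_of_length hlen
  cases hl with
  | nil => rfl
  | @cons _ z _ l hxz hl₁ =>
  obtain ⟨Λ, hΛ, hmem⟩ := exists_hyperplane hxz
  obtain ⟨l, rfl⟩ := hl₁.exists_eq_cons
  have hle := hr.cross_le_one hX hΛ (.cons hxz hl₁)
  have h1 := h Λ hΛ
  rw [sep_iff hX hΛ (.cons hxz hl₁)] at h1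
  rw [cross_cons_of_mem hmem] at hle h1
  obtain h0 : cross Λ (z :: l) = 0 := by omega
  simp [h0] at h1

theorem IsWalk.finite_cross (X : CubeComplex V) (l : List V) :
    {Λ ∈ X.hyperplanes | cross Λ l ≠ 0}.Finite := by
  induction l with
  | nil => simp [cross]
  | cons a l ih =>
    rcases l with _ | ⟨b, l⟩
    · simp [cross]
    · have h1 : {Λ ∈ X.hyperplanes | s(a, b) ∈ Λ}.Finite :=
        Set.Subsingleton.finite fun Λ h Λ' h' => hyperplane_eq h.1 h'.1 h.2 h'.2
      refine (h1.union ih).subset ?_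
      rintro Λ ⟨hΛ, h⟩
      by_cases hab : s(a, b) ∈ Λ
      · exact Or.inl ⟨hΛ, hab⟩
      · rw [cross_cons_of_notMem hab] at h
        exact Or.inr ⟨hΛ, h⟩

theorem finite_sep (hX : X.IsCAT0) (x y : V) : {Λ ∈ X.hyperplanes | X.Sep Λ x y}.Finite := by
  obtain ⟨l, hl, -⟩ := exists_geodesic hX.1 x y
  refine (IsWalk.finite_cross X l).subset ?_
  rintro Λ ⟨hΛ, h⟩
  rw [sep_iff hX hΛ hl] at h
  exact ⟨hΛ, fun h0 => by simp [h0] at h⟩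

/-- Hyperplanes are determined by the pairs of vertices that they separate. -/
theorem hyperplane_eq_of_sep (hX : X.IsCAT0) {Λ Λ' : Set (Sym2 V)} (hΛ : Λ ∈ X.hyperplanes)
    (hΛ' : Λ' ∈ X.hyperplanes) (h : ∀ u v, X.Sep Λ u v → X.Sep Λ' u v) : Λ = Λ' := by
  obtain ⟨e, he, h0⟩ := id hΛ
  have he' : e ∈ Λ := by rw [h0]; exact .refl _
  induction e using Sym2.ind with
  | _ p q =>
  exact hyperplane_eq hΛ hΛ' he'
    ((sep_adj hX hΛ' he).1 (h p q ((sep_adj hX hΛ he).2 he')))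

end CubeComplex

/-! ### Ends of locally finite graphs -/

namespace SimpleGraph

open CategoryTheory

/-- An infinite set of vertices of a connected locally finite graph accumulates at an end. -/
theorem exists_end_of_infinite {W : Type*} (Γ : SimpleGraph W) [Γ.LocallyFinite]
    (hc : Γ.Preconnected) {D : Set W} (hD : D.Infinite) :
    ∃ s ∈ Γ.end, ∀ K : (Finset W)ᵒᵖ, (ComponentCompl.supp (s K) ∩ D).Infinite := by
  classical
  have : Fact Γ.Preconnected := ⟨hc⟩
  -- The components that contain infinitely many points of `D` form an inverse system of nonempty
  -- finite sets; a section of it is the end sought.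
  let F : (Finset W)ᵒᵖ ⥤ Type _ :=
    { obj := fun K => {C : Γ.ComponentCompl K.unop // (C.supp ∩ D).Infinite}
      map := fun f => ↾fun C => ⟨C.1.hom (le_of_op_hom f),
        C.2.mono (Set.inter_subset_inter_left _ (C.1.subset_hom (le_of_op_hom f)))⟩
      map_id := fun K => by
        ext C
        simp [ComponentCompl.hom_refl]
      map_comp := fun f g => ConcreteCategory.hom_ext _ _ fun C =>
        Subtype.ext (C.1.hom_trans (le_of_op_hom f) (le_of_op_hom g)) }
  have : ∀ K, Finite (F.obj K) := fun K =>
    Finite.of_injective (fun C => (C.1 : Γ.ComponentCompl K.unop)) Subtype.val_injective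
  have : ∀ K, Nonempty (F.obj K) := by
    intro K
    by_contra hK
    have hfin : ∀ C : Γ.ComponentCompl K.unop, (C.supp ∩ D).Finite := by
      intro C
      by_contra h
      exact hK ⟨⟨C, h⟩⟩
    have h1 : (⋃ C : Γ.ComponentCompl K.unop, C.supp ∩ D).Finite := Set.finite_iUnion hfin
    refine hD ((h1.union K.unop.finite_toSet).subset fun v hv => ?_)
    by_cases hvK : v ∈ K.unop
    · exact Or.inr hvK
    · exact Or.inl (Set.mem_iUnion.2 ⟨Γ.componentComplMk (K := (K.unop : Set W)) hvK,
        ⟨hvK, rfl⟩, hv⟩)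
  obtain ⟨s, hs⟩ := nonempty_sections_of_finite_inverse_system F
  refine ⟨fun K => (s K).1, fun {K L} f => ?_, fun K => (s K).2⟩
  exact congrArg Subtype.val (hs f)

/-- A connected locally finite graph with an infinite set of vertices with infinite complement
and finite boundary has more than one end. -/
theorem end_nontrivial {W : Type*} (Γ : SimpleGraph W) [Γ.LocallyFinite]
    (hc : Γ.Preconnected) {D K : Set W} (hD : D.Infinite) (hD' : Dᶜ.Infinite) (hK : K.Finite)
    (hbd : ∀ a b, Γ.Adj a b → a ∉ K → b ∉ K → a ∈ D → b ∈ D) : Γ.end.Nontrivial := by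
  obtain ⟨s, hs, h1⟩ := Γ.exists_end_of_infinite hc hD
  obtain ⟨t, ht, h2⟩ := Γ.exists_end_of_infinite hc hD'
  refine ⟨s, hs, t, ht, ?_⟩
  rintro rfl
  obtain ⟨u, ⟨huK, hu⟩, huD⟩ := (h1 (Opposite.op hK.toFinset)).nonempty
  obtain ⟨v, ⟨hvK, hv⟩, hvD⟩ := (h2 (Opposite.op hK.toFinset)).nonempty
  have hr := ConnectedComponent.exact (hu.trans hv.symm)
  obtain ⟨p⟩ := hr
  -- If the ends coincided, one component of the complement of `K` would meet both `D` and its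
  -- complement, so some edge avoiding `K` would leave `D`.
  obtain ⟨⟨⟨x, y⟩, hxy⟩, -, hx, hy⟩ := p.exists_boundary_dart (Subtype.val ⁻¹' D) huD hvD
  exact hy (hbd x y hxy (by simpa using x.2) (by simpa using y.2) hx)

end SimpleGraph

/-! ### A criterion for codimension-1 subgroups -/

section

variable {G : Type*} [Group G] (H : Subgroup G)

theorem quotient_mk_rightRel_eq_iff {g g' : G} :
    Quotient.mk (QuotientGroup.rightRel H) g = Quotient.mk (QuotientGroup.rightRel H) g' ↔
      g' * g⁻¹ ∈ H := by
  rw [Quotient.eq, QuotientGroup.rightRel_apply]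

theorem cayleyQuotient_reachable {S : Set G} (hS : Subgroup.closure S = ⊤) (a g : G) :
    (cayleyQuotient H S).Reachable (Quotient.mk _ a) (Quotient.mk _ (a * g)) := by
  have hg : g ∈ Subgroup.closure S := by rw [hS]; trivial
  induction hg using Subgroup.closure_induction generalizing a with
  | mem s hs =>
    by_cases h : Quotient.mk (QuotientGroup.rightRel H) a = Quotient.mk _ (a * s)
    · rw [h]
    · exact SimpleGraph.Adj.reachable
        ((SimpleGraph.fromRel_adj _ _ _).2 ⟨h, Or.inl ⟨a, s, hs, rfl, rfl⟩⟩)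
  | one => rw [mul_one]
  | mul x y _ _ hx hy => rw [← mul_assoc]; exact (hx a).trans (hy _)
  | inv x _ hx => simpa using (hx (a * x⁻¹)).symm

theorem cayleyQuotient_preconnected {S : Set G} (hS : Subgroup.closure S = ⊤) :
    (cayleyQuotient H S).Preconnected := by
  intro u v
  induction u using Quotient.inductionOn with
  | _ a =>
  induction v using Quotient.inductionOn with
  | _ b => simpa using cayleyQuotient_reachable H hS a (a⁻¹ * b)

theorem cayleyQuotient_finite_neighborSet {S : Set G} (hS : S.Finite)
    (v : Quotient (QuotientGroup.rightRel H)) : ((cayleyQuotient H S).neighborSet v).Finite := by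
  induction v using Quotient.inductionOn with
  | _ a =>
  refine ((hS.image fun s => Quotient.mk (QuotientGroup.rightRel H) (a * s)).union
    (hS.image fun s => Quotient.mk (QuotientGroup.rightRel H) (a * s⁻¹))).subset ?_
  intro w (hw : (cayleyQuotient H S).Adj _ w)
  rcases ((SimpleGraph.fromRel_adj _ _ _).1 hw).2 with ⟨g, s, hs, h1, h2⟩ | ⟨g, s, hs, h1, h2⟩
  · left
    refine ⟨s, hs, ?_⟩
    rw [h2]
    rw [quotient_mk_rightRel_eq_iff] at h1 ⊢
    simpa [mul_assoc] using h1
  · right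
    refine ⟨s, hs, ?_⟩
    rw [h1]
    rw [quotient_mk_rightRel_eq_iff] at h2 ⊢
    simpa [mul_assoc] using H.inv_mem (H.inv_mem h2)

/-- A subgroup `H` is codimension-1 if `G` has an `H`-invariant subset that is, like its
complement, not `H`-finite, and whose coboundary is `H`-finite. -/
theorem isCodimensionOne_of_invariant [Group.FG G] {B : Set G}
    (hB : ∀ h ∈ H, ∀ g, g ∈ B → h * g ∈ B)
    (h1 : (Quotient.mk (QuotientGroup.rightRel H) '' B).Infinite)
    (h2 : (Quotient.mk (QuotientGroup.rightRel H) '' Bᶜ).Infinite)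
    (hbd : ∀ s, (Quotient.mk (QuotientGroup.rightRel H) '' {g | ¬ (g ∈ B ↔ g * s ∈ B)}).Finite) :
    IsCodimensionOne H := by
  refine ⟨inferInstance, fun S hS hcl => ?_⟩
  let : (cayleyQuotient H S).LocallyFinite := fun v =>
    (cayleyQuotient_finite_neighborSet H hS v).fintype
  have hmem : ∀ g, Quotient.mk (QuotientGroup.rightRel H) g ∈
      Quotient.mk (QuotientGroup.rightRel H) '' B ↔ g ∈ B := by
    refine fun g => ⟨?_, fun h => ⟨g, h, rfl⟩⟩
    rintro ⟨g', hg', h⟩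
    rw [quotient_mk_rightRel_eq_iff] at h
    simpa using hB _ h _ hg'
  -- The finite set removed consists of the cosets at which an edge labelled by some `s ∈ S` that
  -- crosses the boundary of `B` starts; every boundary edge has one such endpoint.
  refine SimpleGraph.end_nontrivial _ (cayleyQuotient_preconnected H hcl) h1 (h2.mono ?_)
    (hS.biUnion fun s _ => hbd s) ?_
  · rintro _ ⟨g, hg, rfl⟩ h
    exact hg ((hmem g).1 h)
  · intro a b hab ha hb haD
    simp only [Set.mem_iUnion, not_exists] at ha hb
    rcases ((SimpleGraph.fromRel_adj _ _ _).1 hab).2 with ⟨g, s, hs, rfl, rfl⟩ | ⟨g, s, hs, rfl, rfl⟩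
    · rw [hmem] at haD ⊢
      by_contra h
      exact ha s hs ⟨g, fun h' => h (h'.1 haD), rfl⟩
    · rw [hmem] at haD ⊢
      by_contra h
      exact hb s hs ⟨g, fun h' => h (h'.2 haD), rfl⟩

end

/-! ### The action on hyperplanes and their sides -/

namespace CubeComplex

variable {V : Type*} {X : CubeComplex V} {G : Type*} [Group G] [MulAction G V]

/-- The translate of a set of edges. -/
def translate (g : G) (Λ : Set (Sym2 V)) : Set (Sym2 V) := Sym2.map (fun v => g • v) '' Λ

theorem translate_one (Λ : Set (Sym2 V)) : translate (1 : G) Λ = Λ := by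
  simp [translate]

theorem translate_mul (g g' : G) (Λ : Set (Sym2 V)) :
    translate (g * g') Λ = translate g (translate g' Λ) := by
  rw [translate, translate, translate, ← Set.image_comp, ← Sym2.map_comp]
  simp only [mul_smul]
  rfl

theorem translate_inv_translate (g : G) (Λ : Set (Sym2 V)) :
    translate g⁻¹ (translate g Λ) = Λ := by
  rw [← translate_mul, inv_mul_cancel, translate_one]

theorem translate_translate_inv (g : G) (Λ : Set (Sym2 V)) :
    translate g (translate g⁻¹ Λ) = Λ := by
  rw [← translate_mul, mul_inv_cancel, translate_one]

theorem mem_stabilizer_iff {g : G} {Λ : Set (Sym2 V)} :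
    g ∈ hyperplaneStabilizer G Λ ↔ translate g Λ = Λ := Iff.rfl

theorem mk_mem_translate_iff (g : G) (Λ : Set (Sym2 V)) (a b : V) :
    s(g • a, g • b) ∈ translate g Λ ↔ s(a, b) ∈ Λ := by
  have : s(g • a, g • b) = Sym2.map (fun v => g • v) s(a, b) := rfl
  rw [this]
  exact (Sym2.map.injective (MulAction.injective g)).mem_set_image

theorem IsCubicalAction.adj (ha : X.IsCubicalAction G) (g : G) {a b : V} (h : X.graph.Adj a b) :
    X.graph.Adj (g • a) (g • b) := by
  refine ⟨fun e => h.1 (MulAction.injective g e), ?_⟩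
  have := ha g _ h.2
  rwa [Set.image_pair] at this

theorem IsCubicalAction.square (ha : X.IsCubicalAction G) (g : G) {a b c d : V}
    (h : X.Square a b c d) : X.Square (g • a) (g • b) (g • c) (g • d) := by
  obtain ⟨h1, h2, h3, h4, h5, h6, h7⟩ := h
  refine ⟨fun e => h1 (MulAction.injective g e), fun e => h2 (MulAction.injective g e),
    ha.adj g h3, ha.adj g h4, ha.adj g h5, ha.adj g h6, ?_⟩
  have := ha g _ h7
  simpa [Set.image_insert_eq] using this

theorem IsCubicalAction.eqvGen (ha : X.IsCubicalAction G) (g : G) {e f : Sym2 V}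
    (h : Relation.EqvGen X.Opposite e f) :
    Relation.EqvGen X.Opposite (e.map (fun v => g • v)) (f.map (fun v => g • v)) := by
  induction h with
  | rel _ _ h =>
    obtain ⟨a, b, c, d, hsq, rfl, rfl⟩ := h
    exact .rel _ _ ⟨_, _, _, _, ha.square g hsq, rfl, rfl⟩
  | refl => exact .refl _
  | symm _ _ _ ih => exact .symm _ _ ih
  | trans _ _ _ _ _ ih1 ih2 => exact .trans _ _ _ ih1 ih2

theorem IsCubicalAction.translate_mem (ha : X.IsCubicalAction G) (g : G) {Λ : Set (Sym2 V)}
    (hΛ : Λ ∈ X.hyperplanes) : translate g Λ ∈ X.hyperplanes := by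
  obtain ⟨e, he, rfl⟩ := hΛ
  refine ⟨e.map (fun v => g • v), ?_, ?_⟩
  · induction e using Sym2.ind with
    | _ a b => exact ha.adj g he
  · ext f
    constructor
    · rintro ⟨f, hf, rfl⟩
      exact ha.eqvGen g hf
    · intro hf
      have h := ha.eqvGen g⁻¹ hf
      rw [Sym2.map_map] at h
      refine ⟨f.map (fun v => g⁻¹ • v), ?_, ?_⟩
      · simpa [Function.comp_def] using h
      · rw [Sym2.map_map]
        simp

theorem IsCubicalAction.isWalk (ha : X.IsCubicalAction G) (g : G) {u v : V} {l : List V}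
    (h : X.IsWalk u v l) : X.IsWalk (g • u) (g • v) (l.map fun v => g • v) := by
  induction h with
  | nil => exact .nil _
  | cons h _ ih => exact .cons (ha.adj g h) ih

theorem cross_translate (g : G) (Λ : Set (Sym2 V)) (l : List V) :
    cross (translate g Λ) (l.map fun v => g • v) = cross Λ l := by
  induction l with
  | nil => rfl
  | cons a l ih =>
    rcases l with _ | ⟨b, l⟩
    · rfl
    · simp only [List.map_cons] at ih ⊢
      by_cases h : s(a, b) ∈ Λ
      · rw [cross_cons_of_mem h, cross_cons_of_mem ((mk_mem_translate_iff g Λ a b).2 h), ih]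
      · rw [cross_cons_of_notMem h, cross_cons_of_notMem (mt (mk_mem_translate_iff g Λ a b).1 h),
          ih]

theorem sep_translate (ha : X.IsCubicalAction G) (g : G) (Λ : Set (Sym2 V)) (u v : V) :
    X.Sep (translate g Λ) (g • u) (g • v) ↔ X.Sep Λ u v := by
  have key : ∀ (g : G) (Λ : Set (Sym2 V)) (u v : V), X.Sep Λ u v →
      X.Sep (translate g Λ) (g • u) (g • v) := by
    rintro g Λ u v ⟨l, hl, h⟩
    exact ⟨_, ha.isWalk g hl, by rwa [cross_translate]⟩
  refine ⟨fun h => ?_, key g Λ u v⟩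
  have := key g⁻¹ _ _ _ h
  rwa [translate_inv_translate, inv_smul_smul, inv_smul_smul] at this

theorem sep_smul_right (ha : X.IsCubicalAction G) (g : G) (Λ : Set (Sym2 V)) (u v : V) :
    X.Sep Λ u (g • v) ↔ X.Sep (translate g⁻¹ Λ) (g⁻¹ • u) v := by
  rw [← sep_translate ha g⁻¹, inv_smul_smul]

theorem sep_smul_left (ha : X.IsCubicalAction G) (g : G) (Λ : Set (Sym2 V)) (u v : V) :
    X.Sep Λ (g • u) v ↔ X.Sep (translate g⁻¹ Λ) u (g⁻¹ • v) := by
  rw [← sep_translate ha g⁻¹, inv_smul_smul]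

theorem isWalk_of_walk_deleteEdges {Λ : Set (Sym2 V)} {u v : V}
    (p : (X.graph.deleteEdges Λ).Walk u v) : ∃ l, X.IsWalk u v l ∧ cross Λ l = 0 := by
  induction p with
  | nil => exact ⟨_, .nil _, rfl⟩
  | cons h _ ih =>
    obtain ⟨l, hl, h0⟩ := ih
    rw [SimpleGraph.deleteEdges_adj] at h
    refine ⟨_, .cons h.1 hl, ?_⟩
    obtain ⟨l, rfl⟩ := hl.exists_eq_cons
    rw [cross_cons_of_notMem h.2, h0]

/-- In an action without inversions, a vertex is not separated from its translates under the
stabilizer of a hyperplane by this hyperplane. -/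
theorem ActsWithoutInversions.not_sep (hX : X.IsCAT0) (hi : X.ActsWithoutInversions G)
    {Λ : Set (Sym2 V)} (hΛ : Λ ∈ X.hyperplanes) {g : G} (hg : translate g Λ = Λ) (u : V) :
    ¬ X.Sep Λ u (g • u) := by
  have h := hi Λ hΛ g hg ((X.graph.deleteEdges Λ).connectedComponentMk u)
  have hu : g • u ∈ ((X.graph.deleteEdges Λ).connectedComponentMk u).supp := by
    rw [← h]
    exact ⟨u, rfl, rfl⟩
  obtain ⟨p⟩ := SimpleGraph.ConnectedComponent.exact hu
  obtain ⟨l, hl, h0⟩ := isWalk_of_walk_deleteEdges p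
  rw [sep_comm hX hΛ, sep_iff hX hΛ hl, h0]
  simp

/-- The translates of `Λ` that correspond to the points of the orbit of `y` that are on the
same side of `Λ` as `u`. -/
def sameSide (G : Type*) [Group G] [MulAction G V] (X : CubeComplex V) (Λ : Set (Sym2 V))
    (u y : V) : Set (Set (Sym2 V)) :=
  (fun g : G => translate g⁻¹ Λ) '' {g | ¬ X.Sep Λ u (g • y)}

/-- The orbit of a hyperplane. -/
def orbitOf (G : Type*) [Group G] [MulAction G V] (Λ : Set (Sym2 V)) : Set (Set (Sym2 V)) :=
  Set.range fun g : G => translate g Λ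

theorem finite_image_of_factor {α β γ : Type*} {f : α → β} {k : α → γ}
    (h : ∀ a b, f a = f b → k a = k b) {s : Set α} (hs : (f '' s).Finite) : (k '' s).Finite := by
  rcases isEmpty_or_nonempty α with hα | ⟨⟨a⟩⟩
  · exact (Set.toFinite s).image k
  have : Nonempty γ := ⟨k a⟩
  obtain ⟨e, rfl⟩ := (Function.factorsThrough_iff k).1 (fun a b hab => h a b hab)
  rw [Set.image_comp]
  exact hs.image e

/-- The two sides of a hyperplane whose stabilizer is not codimension-1. -/
theorem finite_sameSide_or (hX : X.IsCAT0) [Group.FG G] (ha : X.IsCubicalAction G)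
    (hi : X.ActsWithoutInversions G) {Λ : Set (Sym2 V)} (hΛ : Λ ∈ X.hyperplanes)
    (hc : ¬ IsCodimensionOne (hyperplaneStabilizer G Λ)) {u u' : V} (hu : X.Sep Λ u u') (y : V) :
    (sameSide G X Λ u y).Finite ∨ (sameSide G X Λ u' y).Finite := by
  -- Cosets of the stabilizer correspond to translates of `Λ`, so finiteness modulo the stabilizer
  -- can be tested on sets of translates.
  have hmk : ∀ g g' : G, Quotient.mk (QuotientGroup.rightRel (hyperplaneStabilizer G Λ)) g =
      Quotient.mk _ g' ↔ translate g⁻¹ Λ = translate g'⁻¹ Λ := by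
    intro g g'
    rw [quotient_mk_rightRel_eq_iff, mem_stabilizer_iff, translate_mul]
    constructor
    · intro h; rw [← h, translate_inv_translate, h]
    · intro h; rw [h, translate_translate_inv]
  by_contra hcon
  push Not at hcon
  refine hc (isCodimensionOne_of_invariant _ (B := {g | ¬ X.Sep Λ u (g • y)}) ?_ ?_ ?_ ?_)
  · intro h hh g hg
    have h1 := sep_trans_iff hX hΛ u (g • y) (h • g • y)
    have h2 := hi.not_sep hX hΛ hh (g • y)
    have hg : ¬ X.Sep Λ u (g • y) := hg
    rw [Set.mem_ofPred_eq, mul_smul]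
    tauto
  · exact fun h => hcon.1 (finite_image_of_factor (fun g g' => (hmk g g').1) h)
  · refine fun h => hcon.2 ?_
    have h' := finite_image_of_factor (fun g g' => (hmk g g').1) h
    refine h'.subset (Set.image_mono fun g hg => ?_)
    have h1 := sep_trans_iff hX hΛ u u' (g • y)
    have hg : ¬ X.Sep Λ u' (g • y) := hg
    simp only [Set.mem_compl_iff, Set.mem_ofPred_eq]
    tauto
  · intro s
    refine finite_image_of_factor (fun g g' => (hmk g g').2) ?_
    -- If `Λ` separates `g • y` from `(g * s) • y`, then its translate by `g⁻¹` separates `y` from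
    -- `s • y`.
    refine (finite_sep hX y (s • y)).subset ?_
    rintro _ ⟨g, hg, rfl⟩
    refine ⟨ha.translate_mem _ hΛ, ?_⟩
    rw [← sep_translate ha g, translate_translate_inv, smul_smul]
    have h1 := sep_trans_iff hX hΛ u (g • y) ((g * s) • y)
    simp only [Set.mem_ofPred_eq] at hg
    tauto

/-- A change of base point adds only translates that separate the two base points. -/
theorem sameSide_finite_base (hX : X.IsCAT0) (ha : X.IsCubicalAction G)
    {Λ : Set (Sym2 V)} (hΛ : Λ ∈ X.hyperplanes) {u y : V} (y' : V)
    (h : (sameSide G X Λ u y).Finite) : (sameSide G X Λ u y').Finite := by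
  refine (h.union (finite_sep hX y y')).subset ?_
  rintro _ ⟨g, hg, rfl⟩
  by_cases hgy : X.Sep Λ u (g • y)
  · refine Or.inr ⟨ha.translate_mem _ hΛ, ?_⟩
    rw [← sep_translate ha g, translate_translate_inv]
    have h1 := sep_trans_iff hX hΛ u (g • y) (g • y')
    simp only [Set.mem_ofPred_eq] at hg
    tauto
  · exact Or.inl ⟨g, hgy, rfl⟩

theorem sameSide_congr (hX : X.IsCAT0) {Λ : Set (Sym2 V)} (hΛ : Λ ∈ X.hyperplanes) {u u' : V}
    (h : ¬ X.Sep Λ u u') (y : V) : sameSide G X Λ u y = sameSide G X Λ u' y := by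
  unfold sameSide
  congr 1
  ext g
  have h1 := sep_trans_iff hX hΛ u u' (g • y)
  simp only [Set.mem_ofPred_eq]
  tauto

/-- Every translate is counted on one of the two sides, so both can be small only if the orbit is
finite. -/
theorem orbitOf_finite_of_sameSide (hX : X.IsCAT0) {Λ : Set (Sym2 V)} (hΛ : Λ ∈ X.hyperplanes)
    {u u' y : V} (hu : X.Sep Λ u u') (h : (sameSide G X Λ u y).Finite)
    (h' : (sameSide G X Λ u' y).Finite) : (orbitOf G Λ).Finite := by
  refine (h.union h').subset ?_
  rintro _ ⟨g, rfl⟩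
  have h1 := sep_trans_iff hX hΛ u u' (g⁻¹ • y)
  by_cases h2 : X.Sep Λ u (g⁻¹ • y)
  · exact Or.inr ⟨g⁻¹, by simp only [Set.mem_ofPred_eq]; tauto, by simp⟩
  · exact Or.inl ⟨g⁻¹, h2, by simp⟩

theorem sameSide_translate (ha : X.IsCubicalAction G) (k : G) (Λ : Set (Sym2 V)) (u y : V) :
    sameSide G X (translate k Λ) (k • u) y = sameSide G X Λ u y := by
  have key : ∀ (k : G) (Λ : Set (Sym2 V)) (u : V),
      sameSide G X (translate k Λ) (k • u) y ⊆ sameSide G X Λ u y := by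
    rintro k Λ u _ ⟨g, hg, rfl⟩
    refine ⟨k⁻¹ * g, ?_, ?_⟩
    · simp only [Set.mem_ofPred_eq] at hg ⊢
      rwa [← sep_translate ha k, smul_smul, mul_inv_cancel_left]
    · simp only [mul_inv_rev, inv_inv, translate_mul]
  refine (key k Λ u).antisymm ?_
  have := key k⁻¹ (translate k Λ) (k • u)
  rwa [translate_inv_translate, inv_smul_smul] at this

theorem orbitOf_translate (k : G) (Λ : Set (Sym2 V)) :
    orbitOf G (translate k Λ) = orbitOf G Λ := by
  ext M
  constructor
  · rintro ⟨g, rfl⟩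
    exact ⟨g * k, translate_mul _ _ _⟩
  · rintro ⟨g, rfl⟩
    refine ⟨g * k⁻¹, ?_⟩
    simp only [translate_mul, translate_inv_translate]

theorem orbitOf_finite_of_finiteIndex (Λ : Set (Sym2 V))
    (h : (hyperplaneStabilizer G Λ).FiniteIndex) : (orbitOf G Λ).Finite := by
  have : Finite (G ⧸ hyperplaneStabilizer G Λ) := Subgroup.finite_quotient_of_finiteIndex
  unfold orbitOf
  rw [← Set.image_univ]
  refine finite_image_of_factor (f := (QuotientGroup.mk : G → G ⧸ hyperplaneStabilizer G Λ))
    ?_ (Set.toFinite _)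
  intro a b hab
  rw [QuotientGroup.eq, mem_stabilizer_iff, translate_mul] at hab
  rw [← translate_translate_inv a (translate b Λ), hab]

open scoped Pointwise in
/-- Consequence of B. H. Neumann's lemma on coverings of a group by cosets. -/
theorem orbitOf_finite_or {Λ Λ' : Set (Sym2 V)} {P Q : Set (Set (Sym2 V))} (hP : P.Finite)
    (hQ : Q.Finite) (h : ∀ g : G, translate g Λ ∈ P ∨ translate g Λ' ∈ Q) :
    (orbitOf G Λ).Finite ∨ (orbitOf G Λ').Finite := by
  classical
  have hsel : ∀ (Λ M : Set (Sym2 V)), ∃ c : G, ∀ g : G, translate g Λ = M →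
      g ∈ c • (hyperplaneStabilizer G Λ : Set G) := by
    intro Λ M
    by_cases hM : ∃ c : G, translate c Λ = M
    · obtain ⟨c, hc⟩ := hM
      refine ⟨c, fun g hg => ?_⟩
      rw [mem_leftCoset_iff, SetLike.mem_coe, mem_stabilizer_iff, translate_mul, hg, ← hc,
        translate_inv_translate]
    · exact ⟨1, fun g hg => absurd ⟨g, hg⟩ hM⟩
  choose c hc using hsel
  -- The elements taking a hyperplane to a prescribed translate lie in one left coset of its
  -- stabilizer. The tag records which hyperplane is meant, so `G` is covered by finitely many
  -- cosets and one of the stabilizers has finite index.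
  let H : Bool → Subgroup G := fun b =>
    if b then hyperplaneStabilizer G Λ else hyperplaneStabilizer G Λ'
  obtain ⟨i, -, hi⟩ := Subgroup.exists_finiteIndex_of_leftCoset_cover
    (s := hP.toFinset.image (fun M => (true, M)) ∪ hQ.toFinset.image (fun M => (false, M)))
    (H := fun i => H i.1) (g := fun i => c (if i.1 then Λ else Λ') i.2) (by
      rw [Set.eq_univ_iff_forall]
      intro g
      rw [Set.mem_iUnion₂]
      rcases h g with h | h
      · exact ⟨(true, translate g Λ), by simpa using h, hc _ _ g rfl⟩
      · exact ⟨(false, translate g Λ'), by simpa using h, hc _ _ g rfl⟩)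
  rcases i with ⟨b, M⟩
  cases b
  · exact Or.inr (orbitOf_finite_of_finiteIndex _ hi)
  · exact Or.inl (orbitOf_finite_of_finiteIndex _ hi)

/-- If `Λ'` has finitely many translates, and its stabilizer moves `Λ` to finitely many
translates, then `Λ` has finitely many translates. -/
theorem orbitOf_finite_of_stabilizer {Λ Λ' : Set (Sym2 V)} (h' : (orbitOf G Λ').Finite)
    {P : Set (Set (Sym2 V))} (hP : P.Finite)
    (h : ∀ g : G, translate g Λ' = Λ' → translate g Λ ∈ P) : (orbitOf G Λ).Finite := by
  have hsel : ∀ M : Set (Sym2 V), ∃ c : G, M ∈ orbitOf G Λ' → translate c Λ' = M := by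
    intro M
    by_cases hM : M ∈ orbitOf G Λ'
    · obtain ⟨c, hc⟩ := hM
      exact ⟨c, fun _ => hc⟩
    · exact ⟨1, fun h => absurd h hM⟩
  choose c hc using hsel
  refine (h'.biUnion fun M _ => hP.image (translate (c M))).subset ?_
  rintro _ ⟨g, rfl⟩
  have hg : translate g Λ' ∈ orbitOf G Λ' := ⟨g, rfl⟩
  refine Set.mem_biUnion hg ⟨translate ((c (translate g Λ'))⁻¹ * g) Λ, h _ ?_, ?_⟩
  · rw [translate_mul]
    conv_lhs => arg 2; rw [← hc _ hg]
    rw [translate_inv_translate]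
  · rw [← translate_mul, mul_inv_cancel_left]

/-- Up to translation, only finitely many hyperplanes separate points of an orbit. -/
theorem exists_finite_representatives (hX : X.IsCAT0) [hG : Group.FG G]
    (ha : X.IsCubicalAction G) (y : V) : ∃ R : Set (Set (Sym2 V)), R.Finite ∧
      ∀ Λ ∈ X.hyperplanes, ∀ g : G, X.Sep Λ y (g • y) → ∃ M ∈ R, Λ ∈ orbitOf G M := by
  obtain ⟨S, hS⟩ := hG.out
  refine ⟨⋃ s ∈ (S : Set G), {Λ ∈ X.hyperplanes | X.Sep Λ y (s • y)},
    S.finite_toSet.biUnion fun s _ => finite_sep hX y (s • y), fun Λ hΛ g => ?_⟩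
  have hg : g ∈ Subgroup.closure (S : Set G) := by rw [hS]; trivial
  -- Only generators are listed in the finite set: a hyperplane separating `y` from `(a * b) • y`
  -- separates `y` from `a • y`, or its translate by `a⁻¹` separates `y` from `b • y`.
  induction hg using Subgroup.closure_induction generalizing Λ with
  | mem s hs => exact fun h => ⟨Λ, Set.mem_biUnion hs ⟨hΛ, h⟩, 1, translate_one Λ⟩
  | one =>
    intro h
    rw [one_smul] at h
    exact absurd h (sep_self hX hΛ y)
  | mul a b _ _ iha ihb =>
    intro h
    by_cases h1 : X.Sep Λ y (a • y)
    · exact iha Λ hΛ h1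
    · have h2 := sep_trans_iff hX hΛ y (a • y) ((a * b) • y)
      have h3 : X.Sep Λ (a • y) (a • b • y) := by rw [smul_smul]; tauto
      rw [sep_smul_left ha, inv_smul_smul] at h3
      obtain ⟨M, hM, c, hc⟩ := ihb _ (ha.translate_mem _ hΛ) h3
      refine ⟨M, hM, a * c, ?_⟩
      simp only at hc ⊢
      rw [translate_mul, hc, translate_translate_inv]
  | inv a _ iha =>
    intro h
    rw [sep_smul_right ha, inv_inv, sep_comm hX (ha.translate_mem _ hΛ)] at h
    obtain ⟨M, hM, c, hc⟩ := iha _ (ha.translate_mem _ hΛ) h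
    refine ⟨M, hM, a⁻¹ * c, ?_⟩
    simp only at hc ⊢
    rw [translate_mul, hc, translate_inv_translate]

/-! ### Leaving the small sides -/

/-- The hyperplanes with infinitely many translates that have `u` on their small side. -/
def bad (G : Type*) [Group G] [MulAction G V] (X : CubeComplex V) (u : V) : Set (Set (Sym2 V)) :=
  {Λ ∈ X.hyperplanes | (orbitOf G Λ).Infinite ∧ (sameSide G X Λ u u).Finite}

theorem mem_bad_iff (hX : X.IsCAT0) (ha : X.IsCubicalAction G) {Λ : Set (Sym2 V)} (u y : V) :
    Λ ∈ bad G X u ↔ Λ ∈ X.hyperplanes ∧ (orbitOf G Λ).Infinite ∧ (sameSide G X Λ u y).Finite :=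
  ⟨fun h => ⟨h.1, h.2.1, sameSide_finite_base hX ha h.1 y h.2.2⟩,
    fun h => ⟨h.1, h.2.1, sameSide_finite_base hX ha h.1 u h.2.2⟩⟩

theorem mem_bad_congr (hX : X.IsCAT0) (ha : X.IsCubicalAction G) {Λ : Set (Sym2 V)}
    (hΛ : Λ ∈ X.hyperplanes) {u u' : V} (h : ¬ X.Sep Λ u u') :
    Λ ∈ bad G X u ↔ Λ ∈ bad G X u' := by
  rw [mem_bad_iff hX ha u u, mem_bad_iff hX ha u' u, sameSide_congr hX hΛ h]

theorem not_mem_bad_of_sep (hX : X.IsCAT0) (ha : X.IsCubicalAction G) {Λ : Set (Sym2 V)}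
    {u u' : V} (h : X.Sep Λ u u') (hu : Λ ∈ bad G X u) : Λ ∉ bad G X u' := by
  rw [mem_bad_iff hX ha u' u]
  exact fun hu' => hu.2.1 (orbitOf_finite_of_sameSide hX hu.1 h hu.2.2 hu'.2.2)

theorem translate_mem_bad (ha : X.IsCubicalAction G) (hX : X.IsCAT0) (g : G) {Λ : Set (Sym2 V)}
    {u : V} (h : Λ ∈ bad G X u) : translate g Λ ∈ bad G X (g • u) := by
  rw [mem_bad_iff hX ha _ u, orbitOf_translate, sameSide_translate ha]
  exact ⟨ha.translate_mem g h.1, h.2⟩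

/-- A bad hyperplane separates two points of the orbit of `u`, as otherwise its whole orbit would be
counted on the small side; so finitely many orbits occur. Within one orbit, fix a bad `Λ`: if its
translate by `g⁻¹` is bad at `u`, then `Λ` is bad at `g • u`, which puts `g • u` on the small side,
and this leaves finitely many translates. -/
theorem finite_bad (hX : X.IsCAT0) [Group.FG G] (ha : X.IsCubicalAction G) (u : V) :
    (bad G X u).Finite := by
  obtain ⟨R, hR, hrel⟩ := exists_finite_representatives hX ha u
  refine (hR.biUnion (t := fun M => {Λ ∈ bad G X u | Λ ∈ orbitOf G M}) fun M _ => ?_).subset ?_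
  · rcases Set.eq_empty_or_nonempty {Λ ∈ bad G X u | Λ ∈ orbitOf G M} with h | ⟨Λ, hΛ, k, rfl⟩
    · rw [h]; exact Set.finite_empty
    · refine hΛ.2.2.subset ?_
      rintro _ ⟨hM, k', rfl⟩
      refine ⟨k * k'⁻¹, fun hsep => ?_, ?_⟩
      · have h1 := translate_mem_bad ha hX (k * k'⁻¹) hM
        simp only [translate_mul, translate_inv_translate] at h1
        exact not_mem_bad_of_sep hX ha hsep hΛ h1
      · simp only [mul_inv_rev, inv_inv, translate_mul, translate_inv_translate]
  · intro Λ hΛ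
    have : ∃ g : G, X.Sep Λ u (g • u) := by
      by_contra hcon
      push Not at hcon
      refine hΛ.2.1 (hΛ.2.2.subset ?_)
      rintro _ ⟨g, rfl⟩
      exact ⟨g⁻¹, hcon _, by simp⟩
    obtain ⟨g, hg⟩ := this
    obtain ⟨M, hM, h⟩ := hrel Λ hΛ.1 g hg
    exact Set.mem_biUnion hM ⟨hΛ, h⟩

/-- Induction on the number of bad hyperplanes. One with minimal side around `u` must be adjacent to
`u`, and crossing it removes it from the bad set without adding any other. -/
theorem exists_bad_eq_empty (hX : X.IsCAT0) [Group.FG G] (ha : X.IsCubicalAction G)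
    (hi : X.ActsWithoutInversions G)
    (hc : ∀ Λ ∈ X.hyperplanes, ¬ IsCodimensionOne (hyperplaneStabilizer G Λ)) (u : V) :
    ∃ u', bad G X u' = ∅ := by
  induction hn : (bad G X u).ncard using Nat.strong_induction_on generalizing u with
  | _ n ih =>
  rcases Set.eq_empty_or_nonempty (bad G X u) with h | hne
  · exact ⟨u, h⟩
  obtain ⟨Λ, hΛ, hmin⟩ := (finite_bad hX ha u).exists_minimalFor
    (fun Λ => {z | ¬ X.Sep Λ u z}) _ hne
  by_cases hadj : ∃ y, s(u, y) ∈ Λ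
  · obtain ⟨y, hy⟩ := hadj
    have huy := adj_of_mem_hyperplane hΛ.1 hy
    refine ih _ ?_ y rfl
    rw [← hn]
    refine Set.ncard_lt_ncard ⟨fun M hM => ?_, fun hsub => ?_⟩ (finite_bad hX ha u)
    · rw [mem_bad_congr hX ha hM.1]
      · exact hM
      · rw [sep_adj hX hM.1 huy]
        intro h
        obtain rfl := hyperplane_eq hΛ.1 hM.1 hy h
        exact not_mem_bad_of_sep hX ha ((sep_adj hX hM.1 huy).2 h) hΛ hM
    · exact not_mem_bad_of_sep hX ha ((sep_adj hX hΛ.1 huy).2 hy) hΛ (hsub hΛ)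
  · push Not at hadj
    -- Suppose `Λ` is not adjacent to `u`: then some `k` bounds a strictly smaller halfspace around
    -- `u`, and by minimality of `Λ` it is not bad.
    obtain ⟨k, hk, hlt⟩ := exists_halfspace_ssubset hX hΛ.1 hadj
    have hsub : ∀ z, ¬ X.Sep k u z → ¬ X.Sep Λ u z := fun z hz => hlt.1 hz
    -- The stabilizer of `k` keeps `u` on its side of `k`, hence on the small side of `Λ`, so it
    -- moves `Λ` to finitely many translates only.
    have hinf : (orbitOf G k).Infinite := by
      intro hfin
      refine hΛ.2.1 (orbitOf_finite_of_stabilizer hfin hΛ.2.2 fun g hg => ?_)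
      refine ⟨g⁻¹, hsub _ (hi.not_sep hX hk ?_ u), by simp⟩
      conv_lhs => rw [← hg]
      exact translate_inv_translate g k
    have hkbad : k ∉ bad G X u := fun hkb => hlt.2 (hmin hkb hlt.1)
    obtain ⟨z, hz⟩ : ∃ z, X.Sep k u z := by
      obtain ⟨z, hz, hz'⟩ := Set.not_subset.1 hlt.2
      exact ⟨z, by simpa using hz'⟩
    have hfin : (sameSide G X k z u).Finite := by
      rcases finite_sameSide_or hX ha hi hk (hc k hk) hz u with h | h
      · exact absurd ⟨hk, hinf, h⟩ hkbad
      · exact h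
    -- The small side of `k` is the one away from `u`, so the small sides of `Λ` and `k` cover all
    -- vertices, and every `g` takes `Λ` or `k` into a finite set of translates.
    rcases orbitOf_finite_or (G := G) (Λ := Λ) (Λ' := k) hΛ.2.2 hfin (fun g => by
      by_cases h : X.Sep k u (g⁻¹ • u)
      · right
        have h1 := sep_trans_iff hX hk u z (g⁻¹ • u)
        exact ⟨g⁻¹, by simp only [Set.mem_ofPred_eq]; tauto, by simp⟩
      · left
        exact ⟨g⁻¹, hsub _ h, by simp⟩) with h | h
    · exact absurd h hΛ.2.1
    · exact absurd h hinf

/-! ### Essential hyperplanes and the fixed vertex -/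

/-- The hyperplanes that separate two points of the orbit of `y`. -/
def essential (G : Type*) [Group G] [MulAction G V] (X : CubeComplex V) (y : V) :
    Set (Set (Sym2 V)) :=
  {Λ ∈ X.hyperplanes | ∃ g g' : G, X.Sep Λ (g • y) (g' • y)}

theorem essential_smul (g : G) (y : V) : essential G X (g • y) = essential G X y := by
  ext Λ
  constructor
  · rintro ⟨hΛ, a, b, h⟩
    exact ⟨hΛ, a * g, b * g, by rwa [mul_smul, mul_smul]⟩
  · rintro ⟨hΛ, a, b, h⟩
    exact ⟨hΛ, a * g⁻¹, b * g⁻¹, by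
      rwa [smul_smul, smul_smul, inv_mul_cancel_right, inv_mul_cancel_right]⟩

theorem translate_mem_essential (ha : X.IsCubicalAction G) (g : G) {y : V} {Λ : Set (Sym2 V)}
    (h : Λ ∈ essential G X y) : translate g Λ ∈ essential G X y := by
  obtain ⟨hΛ, a, b, h⟩ := h
  exact ⟨ha.translate_mem g hΛ, g * a, g * b, by rwa [mul_smul, mul_smul, sep_translate ha]⟩

/-- An essential hyperplane has points of the orbit of `y` on both sides. With an infinite orbit it
would have one of them on its small side, against `hy`; so it has a finite orbit, and finitely many
orbits occur. -/
theorem finite_essential (hX : X.IsCAT0) [Group.FG G] (ha : X.IsCubicalAction G)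
    (hi : X.ActsWithoutInversions G)
    (hc : ∀ Λ ∈ X.hyperplanes, ¬ IsCodimensionOne (hyperplaneStabilizer G Λ)) {y : V}
    (hy : bad G X y = ∅) : (essential G X y).Finite := by
  obtain ⟨R, hR, hrel⟩ := exists_finite_representatives hX ha y
  have hbad : ∀ Λ (g : G), Λ ∉ bad G X (g • y) := by
    intro Λ g h
    have := translate_mem_bad ha hX g⁻¹ h
    rw [inv_smul_smul, hy] at this
    exact this
  refine ((hR.subset (Set.sep_subset R fun M => (orbitOf G M).Finite)).biUnion
    (t := fun M => orbitOf G M) fun M hM => hM.2).subset ?_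
  rintro Λ ⟨hΛ, g, g', h⟩
  have hfin : (orbitOf G Λ).Finite := by
    by_contra hinf
    rcases finite_sameSide_or hX ha hi hΛ (hc Λ hΛ) h y with h | h
    · exact hbad Λ g ((mem_bad_iff hX ha _ y).2 ⟨hΛ, hinf, h⟩)
    · exact hbad Λ g' ((mem_bad_iff hX ha _ y).2 ⟨hΛ, hinf, h⟩)
  rw [sep_smul_left ha, smul_smul] at h
  obtain ⟨M, hM, c, hc⟩ := hrel _ (ha.translate_mem _ hΛ) _ h
  have hΛM : Λ = translate (g * c) M := by
    simp only at hc
    rw [translate_mul, hc, translate_translate_inv]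
  refine Set.mem_biUnion (x := M) ⟨hM, ?_⟩ ⟨g * c, hΛM.symm⟩
  rwa [hΛM, orbitOf_translate] at hfin

/-- Crossing simultaneously finitely many pairwise crossing hyperplanes that are dual to edges
at `y`. -/
theorem exists_flip (hX : X.IsCAT0) {T : Set (Set (Sym2 V))} (hT : T.Finite) (y : V)
    (hhyp : T ⊆ X.hyperplanes) (hadj : ∀ M ∈ T, ∃ z, s(y, z) ∈ M)
    (hcross : ∀ M ∈ T, ∀ M' ∈ T, M ≠ M' → ∃ t, X.Sep M y t ∧ X.Sep M' y t) :
    ∃ y', ∀ k ∈ X.hyperplanes, X.Sep k y y' ↔ k ∈ T := by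
  induction T, hT using Set.Finite.induction_on generalizing y with
  | empty => exact ⟨y, fun k hk => by simpa using sep_self hX hk y⟩
  | @insert M T hMT _ ih =>
    obtain ⟨hM, hT⟩ := Set.insert_subset_iff.1 hhyp
    obtain ⟨z, hz⟩ := hadj M (Set.mem_insert _ _)
    have hyz := adj_of_mem_hyperplane hM hz
    have hnot : ∀ k ∈ X.hyperplanes, k ≠ M → ¬ X.Sep k y z := by
      intro k hk hne h
      rw [sep_adj hX hk hyz] at h
      exact hne (hyperplane_eq hk hM h hz)
    have hne : ∀ M' ∈ T, M' ≠ M := fun M' h e => hMT (e ▸ h)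
    have hflip := ih z hT ?_ ?_
    -- Passing from `y` to `z` crosses `M` only; the squares at `y` keep the remaining hyperplanes
    -- adjacent to `z`, so they can be crossed from there.
    · obtain ⟨y', hy'⟩ := hflip
      refine ⟨y', fun k hk => ?_⟩
      rw [sep_trans_iff hX hk y z y', hy' k hk, Set.mem_insert_iff]
      by_cases hkM : k = M
      · subst hkM
        have := (sep_adj hX hk hyz).2 hz
        tauto
      · have := hnot k hk hkM
        tauto
    · intro M' hM'
      obtain ⟨z', hz'⟩ := hadj M' (Set.mem_insert_of_mem _ hM')
      obtain ⟨t, ht, ht'⟩ := hcross M (Set.mem_insert _ _) M' (Set.mem_insert_of_mem _ hM')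
        (hne M' hM').symm
      obtain ⟨w, hsq⟩ := exists_square hX hM (hT hM') (hne M' hM').symm hz hz' ht ht'
      refine ⟨w, ?_⟩
      have := (hsq.adcb.mem_hyperplane_iff (hT hM')).1 hz'
      exact this
    · intro M₁ h₁ M₂ h₂ h12
      obtain ⟨t, ht₁, ht₂⟩ := hcross M₁ (Set.mem_insert_of_mem _ h₁) M₂
        (Set.mem_insert_of_mem _ h₂) h12
      refine ⟨t, ?_, ?_⟩
      · have h3 := sep_trans_iff hX (hT h₁) y z t
        have h4 := hnot M₁ (hT h₁) (hne M₁ h₁)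
        tauto
      · have h3 := sep_trans_iff hX (hT h₂) y z t
        have h4 := hnot M₂ (hT h₂) (hne M₂ h₂)
        tauto

/-- The vertex `y` is moved out of every translate of the minimal halfspace that contains it. No
translate of `Λ` is then essential, and other hyperplanes are not crossed by the move. -/
theorem exists_essential_ssubset (hX : X.IsCAT0) (ha : X.IsCubicalAction G)
    (hi : X.ActsWithoutInversions G) {y : V} (hfin : (essential G X y).Finite)
    {Λ : Set (Sym2 V)} (hΛ : Λ ∈ essential G X y)
    (hmin : ∀ M ∈ essential G X y, ∀ g : G,
      {z | ¬ X.Sep M (g • y) z} ⊆ {z | ¬ X.Sep Λ y z} →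
      {z | ¬ X.Sep Λ y z} ⊆ {z | ¬ X.Sep M (g • y) z}) :
    ∃ y', essential G X y' ⊂ essential G X y := by
  have hmin' : ∀ (c : G), ∀ M ∈ essential G X y, ∀ g : G,
      (∀ z, ¬ X.Sep M (g • y) z → ¬ X.Sep (translate c Λ) (c • y) z) →
      ∀ z, ¬ X.Sep (translate c Λ) (c • y) z → ¬ X.Sep M (g • y) z := by
    intro c M hM g h z hz
    have h1 := hmin _ (translate_mem_essential ha c⁻¹ hM) (c⁻¹ * g) ?_ (a := c⁻¹ • z) ?_
    · simp only [Set.mem_ofPred_eq] at h1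
      rwa [mul_smul, sep_translate ha] at h1
    · intro z hz
      simp only [Set.mem_ofPred_eq] at hz ⊢
      have h2 := h (c • z)
      rw [sep_translate ha] at h2
      refine h2 ?_
      rwa [← sep_translate ha c⁻¹, smul_smul, inv_smul_smul]
    · simp only [Set.mem_ofPred_eq]
      rwa [← sep_translate ha c, smul_inv_smul]
  let T : Set (Set (Sym2 V)) :=
    {M | ∃ g : G, M = translate g Λ ∧ ¬ X.Sep M y (g • y)}
  have hTE : T ⊆ essential G X y := by
    rintro _ ⟨g, rfl, -⟩
    exact translate_mem_essential ha g hΛ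
  -- Without inversions, the translate of the halfspace depends only on the hyperplane `M` and not
  -- on the element that takes `Λ` to it.
  have hwd : ∀ M ∈ T, ∀ c : G, M = translate c Λ → ¬ X.Sep M y (c • y) := by
    rintro M ⟨g, hg, h⟩ c hc
    have hM : M ∈ X.hyperplanes := hg ▸ ha.translate_mem g hΛ.1
    have h1 := hi.not_sep hX hM (g := c * g⁻¹) ?_ (g • y)
    · rw [smul_smul, inv_mul_cancel_right] at h1
      have := sep_trans_iff hX hM y (g • y) (c • y)
      tauto
    · conv_lhs => rw [hg]
      rw [translate_mul, translate_inv_translate, hc]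
  have hout : ∀ M ∈ essential G X y, ∃ g : G, X.Sep M y (g • y) := by
    rintro M ⟨hM, a, b, h⟩
    by_contra hcon
    push Not at hcon
    have h1 := sep_trans_iff hX hM y (a • y) (b • y)
    have h2 := hcon a
    have h3 := hcon b
    tauto
  have hminT : ∀ M ∈ T, ∀ k ∈ essential G X y, ∀ g : G,
      (∀ z, ¬ X.Sep k (g • y) z → ¬ X.Sep M y z) → ∀ z, ¬ X.Sep M y z → ¬ X.Sep k (g • y) z := by
    rintro M ⟨c, rfl, hc⟩ k hk g h
    have hM := ha.translate_mem c hΛ.1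
    have hiff : ∀ z, X.Sep (translate c Λ) y z ↔ X.Sep (translate c Λ) (c • y) z := by
      intro z
      have := sep_trans_iff hX hM y (c • y) z
      tauto
    simp only [hiff] at h ⊢
    exact hmin' c k hk g h
  have hex := exists_flip hX (hfin.subset hTE) y (fun M hM => (hTE hM).1) ?_ ?_
  · obtain ⟨y', hy'⟩ := hex
    have hflip : ∀ M ∈ X.hyperplanes, ∀ (c : G), M = translate c Λ → X.Sep M y' (c • y) := by
      intro M hM c hc
      have h1 := sep_trans_iff hX hM y' y (c • y)
      rw [sep_comm hX hM (u := y') (v := y), hy' M hM] at h1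
      by_cases h2 : M ∈ T
      · have := hwd M h2 c hc
        tauto
      · have : X.Sep M y (c • y) := by
          by_contra h3
          exact h2 ⟨c, hc, h3⟩
        tauto
    -- By `hflip`, both `y'` and `g • y'` lie outside the translate of the halfspace bounded by `M`.
    have hnot : ∀ M ∈ X.hyperplanes, M ∈ orbitOf G Λ → ∀ g : G, ¬ X.Sep M y' (g • y') := by
      rintro M hM ⟨c, hc⟩ g
      have h1 := hflip M hM c hc.symm
      have h2 := hflip (translate g⁻¹ M) (ha.translate_mem _ hM) (g⁻¹ * c)
        (by rw [translate_mul, ← hc])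
      rw [mul_smul, ← sep_smul_left ha] at h2
      have h3 := sep_trans_iff hX hM y' (g • y') (c • y)
      tauto
    refine ⟨y', fun M hM => ?_, fun hsub => ?_⟩
    · obtain ⟨hM, a, b, h⟩ := hM
      rw [sep_smul_left ha, smul_smul] at h
      have hM' := ha.translate_mem a⁻¹ hM
      have hT : ∀ g : G, translate g (translate a⁻¹ M) ∉ T := by
        rintro g ⟨c, hc, -⟩
        refine hnot _ hM' ⟨g⁻¹ * c, ?_⟩ _ h
        simp only
        rw [translate_mul, ← hc, translate_inv_translate]
      have h1 := hy' _ hM'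
      have h2 := hy' _ (ha.translate_mem (a⁻¹ * b)⁻¹ hM')
      have h3 := hT (a⁻¹ * b)⁻¹
      have h4 := hT 1
      rw [translate_one] at h4
      rw [← sep_translate ha (a⁻¹ * b), translate_translate_inv] at h2
      have h5 := sep_trans_iff hX hM' y y' ((a⁻¹ * b) • y')
      have h6 := sep_trans_iff hX hM' y ((a⁻¹ * b) • y) ((a⁻¹ * b) • y')
      have h7 : translate a⁻¹ M ∈ essential G X y :=
        ⟨hM', 1, a⁻¹ * b, by rw [one_smul]; tauto⟩
      have := translate_mem_essential ha a h7
      rwa [translate_translate_inv] at this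
    · obtain ⟨-, a, b, h⟩ := hsub hΛ
      rw [sep_smul_left ha, smul_smul] at h
      exact hnot _ (ha.translate_mem _ hΛ.1) ⟨a⁻¹, rfl⟩ _ h
  · intro M hM
    by_contra hcon
    push Not at hcon
    -- If no edge at `y` were dual to `M`, a strictly smaller halfspace around `y` would exist. Its
    -- hyperplane is again essential, since an orbit point across `M` is across `k` as well; this
    -- contradicts minimality.
    obtain ⟨k, hk, hlt⟩ := exists_halfspace_ssubset hX (hTE hM).1 hcon
    refine hlt.2 ?_
    obtain ⟨g, hg⟩ := hout M (hTE hM)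
    have hkE : k ∈ essential G X y :=
      ⟨hk, 1, g, by
        rw [one_smul]
        by_contra h
        exact hlt.1 h hg⟩
    have := hminT M hM k hkE 1
    rw [one_smul] at this
    exact this hlt.1
  · intro M hM M' hM' hne
    by_contra hcon
    push Not at hcon
    obtain ⟨g, hg⟩ := hout M (hTE hM)
    have hh := (hTE hM).1
    have hh' := (hTE hM').1
    have hiff : ∀ z, ¬ X.Sep M (g • y) z ↔ X.Sep M y z := by
      intro z
      have := sep_trans_iff hX hh y (g • y) z
      tauto
    -- If `M` and `M'` did not cross in this way, the far side of `M`, which contains `g • y`, would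
    -- lie in the side of `M'` around `y`. By minimality the two are equal, so `M = M'`.
    have h1 := hminT M' hM' M (hTE hM) g fun z hz => hcon z ((hiff z).1 hz)
    simp only [hiff] at h1
    refine hne (hyperplane_eq_of_sep hX hh hh' fun u v huv => ?_)
    have h2 := sep_trans_iff hX hh u y v
    have h3 := sep_trans_iff hX hh' u y v
    have h4 := sep_comm hX hh (u := u) (v := y)
    have h5 := sep_comm hX hh' (u := u) (v := y)
    have h6 := hcon u
    have h7 := hcon v
    have h8 := h1 u
    have h9 := h1 v
    tauto

theorem exists_fixed_of_finite_essential (hX : X.IsCAT0) (ha : X.IsCubicalAction G)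
    (hi : X.ActsWithoutInversions G) {y : V} (hfin : (essential G X y).Finite) :
    ∃ v : V, ∀ g : G, g • v = v := by
  induction hn : (essential G X y).ncard using Nat.strong_induction_on generalizing y with
  | _ n ih =>
  rcases Set.eq_empty_or_nonempty (essential G X y) with h | ⟨M₀, hM₀⟩
  · refine ⟨y, fun g => (eq_of_forall_not_sep hX fun Λ hΛ hsep => ?_).symm⟩
    have : Λ ∈ essential G X y := ⟨hΛ, 1, g, by rwa [one_smul]⟩
    rw [h] at this
    exact this
  have hfin' : {p : Set V | ∃ M ∈ essential G X y, ∃ g : G,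
      p = {z | ¬ X.Sep M (g • y) z}}.Finite := by
    refine (hfin.biUnion (t := fun M => {{z | ¬ X.Sep M y z}, {z | X.Sep M y z}})
      fun M _ => Set.toFinite _).subset ?_
    rintro _ ⟨M, hM, g, rfl⟩
    refine Set.mem_biUnion hM ?_
    simp only [Set.mem_insert_iff, Set.mem_singleton_iff]
    by_cases h : X.Sep M y (g • y)
    · right
      ext z
      have := sep_trans_iff hX hM.1 y (g • y) z
      simp only [Set.mem_ofPred_eq]
      tauto
    · left
      ext z
      have := sep_trans_iff hX hM.1 y (g • y) z
      simp only [Set.mem_ofPred_eq]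
      tauto
  obtain ⟨_, ⟨Λ, hΛ, g, rfl⟩, hmin⟩ := hfin'.exists_minimalFor id _ ⟨_, M₀, hM₀, 1, rfl⟩
  -- The minimal halfspace lies around `g • y`, which replaces `y` as base point without changing
  -- the essential hyperplanes.
  rw [← essential_smul g] at hfin hΛ
  obtain ⟨y', hy'⟩ := exists_essential_ssubset hX ha hi hfin hΛ (by
    intro M hM c h
    rw [essential_smul] at hM
    exact hmin (j := {z | ¬ X.Sep M (c • g • y) z}) ⟨M, hM, c * g, by rw [mul_smul]⟩ h)
  refine ih _ ?_ (hfin.subset hy'.1) rfl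
  rw [← hn, ← essential_smul g y]
  exact Set.ncard_lt_ncard hy' hfin

end CubeComplex

theorem mainTheorem5 {G : Type*} [Group G] [Group.FG G] {V : Type*} [MulAction G V]
    (X : CubeComplex V) (hX : X.IsCAT0)
    (hact : X.IsCubicalAction G)
    (hinv : X.ActsWithoutInversions G)
    (hfix : ¬ ∃ v : V, ∀ g : G, g • v = v) :
    ∃ Λ ∈ X.hyperplanes, IsCodimensionOne (CubeComplex.hyperplaneStabilizer G Λ) := by
  by_contra hcon
  push Not at hcon
  obtain ⟨v⟩ := hX.1.1.nonempty
  obtain ⟨y, hy⟩ := CubeComplex.exists_bad_eq_empty hX hact hinv hcon v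
  exact hfix (CubeComplex.exists_fixed_of_finite_essential hX hact hinv
    (CubeComplex.finite_essential hX hact hinv hcon hy))
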